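/- Let $G$ be a (Hausdorff) locally compact group. Let $M(G)$ be the space of complex regular Borel measures on $G$, where $\mu*\nu\in M(G)$ is determined by $\int g\,d(\mu*\nu)=\int\!\int g(xy)\,d\mu(x)\,d\nu(y)$ for $g\in C_0(G)$. A generalised function on $G$ is a family $f=(f_\mu)_{\mu\in M(G)}$ with $f_\mu\in L^\infty(|\mu|)$ such that $f_\mu=f_\nu$ $|\mu|$-a.e. whenever $|\mu|\ll|\nu|$ (such a family is automatically bounded); $GL(G)$ is the space of all generalised functions with the norm $\|f\|=\sup_\mu\|f_\mu\|_{L^\infty(|\mu|)}$. It is identified with $M(G)^*$ through the pairing $\langle f,\zeta\rangle=\int f_\zeta\,d\zeta$. Let $GL_0(G)\subseteq GL(G)$ be the subspace of those $f$ that vanish at infinity: for each $\varepsilon>0$ there is a compact $K\subseteq G$ such that for every $\mu\in M(G)$ one has $|f_\mu(x)|<\varepsilon$ for $|\mu|$-almost all $x\in G\setminus K$. For $f\in GL(G)$ and $\zeta\in M(G)$ define $f\zeta,\ \zeta f$ by $\langle f\zeta,\mu\rangle=\langle f,\zeta*\mu\rangle$ and $\langle \zeta f,\mu\rangle=\langle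 f,\mu*\zeta\rangle$ for all $\mu\in M(G)$. **Proposition.** $GL_0(G)$ is left and right topologically introverted in $GL(G)$. That is: 1. For all $f\in GL_0(G)$ and $\zeta\in M(G)$ there is exactly one element $f\zeta$ of $GL_0(G)$ with $\langle f\zeta,\mu\rangle=\langle f,\zeta*\mu\rangle$ for all $\mu\in M(G)$; and for every bounded linear functional $m\in GL_0(G)^*$ and $f\in GL_0(G)$ there is exactly one element $mf$ of $GL_0(G)$ with $\langle mf,\zeta\rangle=\langle m,f\zeta\rangle$ for all $\zeta\in M(G)$. 2. For all $f\in GL_0(G)$ and $\zeta\in M(G)$ there is exactly one element $\zeta f$ of $GL_0(G)$ with $\langle \zeta f,\mu\rangle=\langle f,\mu*\zeta\rangle$ for all $\mu\in M(G)$; and for every $m\in GL_0(G)^*$ and $f\in GL_0(G)$ there is exactly one element $fm$ of $GL_0(G)$ with $\langle fm,\zeta\rangle=\langle m,\zeta f\rangle$ for all $\zeta\in M(G)$. Consequently the Arens product is well defined on $GL_0(G)^*$: for all $m,n\in GL_0(G)^*$ there is exactly one $m\odot n\in GL_0(G)^*$ with $\langle m\odot n,f\rangle=\langle m,nf\rangle$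 for all $f\in GL_0(G)$. -/

import Mathlib

set_option linter.unusedSectionVars false

namespace GeneralisedFunctions

/-! The measure algebra `M(G)`, Wong's generalised functions `GL(G)`, those vanishing at infinity,
and topological introversion. -/

open MeasureTheory Filter Topology Set
open scoped NNReal ENNReal ZeroAtInfty CompactlySupported

section Aux

variable {X : Type*} [MeasurableSpace X]

/-- A complex measure has finite total variation. -/
theorem isFiniteMeasure_variation (μ : ComplexMeasure X) : IsFiniteMeasure μ.variation := by
  have hle : μ.variation ≤ (ComplexMeasure.re μ).totalVariation +
      (ComplexMeasure.im μ).totalVariation := by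
    refine VectorMeasure.variation_le_of_forall_enorm_le (fun E hE => ?_)
    have h1 := SignedMeasure.enorm_le_totalVariation (ComplexMeasure.re μ) E
    have h2 := SignedMeasure.enorm_le_totalVariation (ComplexMeasure.im μ) E
    rw [Measure.add_apply]
    refine le_trans ?_ (add_le_add h1 h2)
    have e1 : (ComplexMeasure.re μ) E = (μ E).re := rfl
    have e2 : (ComplexMeasure.im μ) E = (μ E).im := rfl
    rw [e1, e2, ← ofReal_norm, ← ofReal_norm, ← ofReal_norm,
      ← ENNReal.ofReal_add (norm_nonneg _) (norm_nonneg _)]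
    exact ENNReal.ofReal_le_ofReal (Complex.norm_le_abs_re_add_abs_im _)
  have : IsFiniteMeasure ((ComplexMeasure.re μ).totalVariation +
      (ComplexMeasure.im μ).totalVariation) := by
    unfold SignedMeasure.totalVariation
    infer_instance
  exact isFiniteMeasure_of_le _ hle

/-- A measure dominated by a finite regular measure is regular. -/
theorem regular_of_le [TopologicalSpace X] [BorelSpace X] [R1Space X] {τ ρ : Measure X}
    [IsFiniteMeasure ρ] [ρ.Regular] (h : τ ≤ ρ) : τ.Regular := by
  have : IsFiniteMeasure τ := isFiniteMeasure_of_le _ h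
  have hO : τ.OuterRegular := by
    refine ⟨fun A hA r hr => ?_⟩
    obtain ⟨ε, hε, hε'⟩ : ∃ ε : ℝ≥0∞, ε ≠ 0 ∧ τ A + ε < r := by
      obtain ⟨s, hs1, hs2⟩ := exists_between hr
      refine ⟨s - τ A, (tsub_pos_of_lt hs1).ne', ?_⟩
      rwa [add_tsub_cancel_of_le hs1.le]
    obtain ⟨U, hAU, hU, -, hd⟩ := hA.exists_isOpen_sdiff_lt (μ := ρ) (measure_ne_top _ _) hε
    refine ⟨U, hAU, hU, lt_of_le_of_lt ?_ hε'⟩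
    calc τ U ≤ τ (A ∪ U \ A) := measure_mono (by simp)
      _ ≤ τ A + τ (U \ A) := measure_union_le _ _
      _ ≤ τ A + ε := by gcongr; exact (h _).trans hd.le
  refine { hO with innerRegular := ?_, lt_top_of_isCompact := fun K _ => measure_lt_top _ _ }
  intro U hU r hr
  obtain ⟨ε, hε, hε'⟩ : ∃ ε : ℝ≥0∞, ε ≠ 0 ∧ r + ε < τ U := by
    obtain ⟨s, hs1, hs2⟩ := exists_between hr
    refine ⟨s - r, (tsub_pos_of_lt hs1).ne', ?_⟩
    rwa [add_tsub_cancel_of_le hs1.le]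
  obtain ⟨K, hKU, hK, -, hd⟩ := hU.measurableSet.exists_isCompact_isClosed_sdiff_lt (μ := ρ) (measure_ne_top _ _) hε
  refine ⟨K, hKU, hK, ?_⟩
  by_contra hcon
  push Not at hcon
  have : τ U ≤ r + ε := calc
      τ U ≤ τ (K ∪ U \ K) := measure_mono (by simp)
      _ ≤ τ K + τ (U \ K) := measure_union_le _ _
      _ ≤ r + ε := by gcongr; exact (h _).trans hd.le
  exact absurd hε' (not_lt.2 this)

end Aux

section Group

variable {G : Type*} [Group G] [TopologicalSpace G] [IsTopologicalGroup G]
  [LocallyCompactSpace G] [T2Space G] [MeasurableSpace G] [BorelSpace G]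

theorem zeroAtInfty_translate_unif {E : Type*} [NormedAddCommGroup E] {f : G → E} (hf : Continuous f)
    (h0 : Tendsto f (cocompact G) (𝓝 0)) (y₀ : G) {ε : ℝ} (hε : 0 < ε) :
    ∀ᶠ y in 𝓝 y₀, ∀ x, ‖f (x * y) - f (x * y₀)‖ < ε := by
  let _ : UniformSpace G := IsTopologicalGroup.leftUniformSpace G
  have hu : UniformContinuous f := hf.uniformContinuous_of_tendsto_cocompact h0
  have h1 := hu (Metric.dist_mem_uniformity hε)
  obtain ⟨V, hV, hVs⟩ := mem_comap.1 (mem_map.1 h1)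
  have h2 : Tendsto (fun y => y⁻¹ * y₀) (𝓝 y₀) (𝓝 1) := by
    have : Continuous fun y : G => y⁻¹ * y₀ := by fun_prop
    simpa using this.tendsto y₀
  filter_upwards [h2 hV] with y hy x
  rw [← dist_eq_norm]
  refine hVs (a := (x * y, x * y₀)) ?_
  simpa [mul_assoc] using hy

theorem zeroAtInfty_bdd {E : Type*} [NormedAddCommGroup E] {f : G → E} (hf : Continuous f)
    (h0 : Tendsto f (cocompact G) (𝓝 0)) : ∃ C, 0 ≤ C ∧ ∀ x, ‖f x‖ ≤ C := by
  let F : C₀(G, E) := ⟨⟨f, hf⟩, h0⟩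
  exact ⟨‖F.toBCF‖, norm_nonneg _, fun x => F.toBCF.norm_coe_le_norm x⟩

theorem zeroAtInfty_mul_right {E : Type*} [NormedAddCommGroup E] {f : G → E}
    (h0 : Tendsto f (cocompact G) (𝓝 0)) (y : G) : Tendsto (fun x => f (x * y)) (cocompact G) (𝓝 0) := 
  h0.comp (Homeomorph.mulRight y).isClosedEmbedding.tendsto_cocompact

theorem integrable_of_cont_bdd {E : Type*} [NormedAddCommGroup E] [SecondCountableTopology E] {f : G → E} (hf : Continuous f)
    {C : ℝ} (h0 : ∀ x, ‖f x‖ ≤ C) (a : Measure G) [IsFiniteMeasure a] : Integrable f a := by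
  borelize E
  exact Integrable.of_bound hf.aestronglyMeasurable C (Eventually.of_forall h0)

theorem continuous_integral_translate {E : Type*} [NormedAddCommGroup E] [NormedSpace ℝ E]
    [SecondCountableTopology E] {f : G → E} (hf : Continuous f)
    (h0 : Tendsto f (cocompact G) (𝓝 0)) (a : Measure G) [IsFiniteMeasure a] :
    Continuous fun y => ∫ x, f (x * y) ∂a := by
  obtain ⟨C, hC, hb⟩ := zeroAtInfty_bdd hf h0
  refine continuous_iff_continuousAt.2 fun y₀ => Metric.tendsto_nhds.2 fun ε hε => ?_
  have hpos : 0 < a.real univ + 1 := by positivity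
  filter_upwards [zeroAtInfty_translate_unif hf h0 y₀ (div_pos hε hpos)] with y hy
  rw [dist_eq_norm, ← integral_sub (integrable_of_cont_bdd (by fun_prop) (fun x => hb _) a)
    (integrable_of_cont_bdd (by fun_prop) (fun x => hb _) a)]
  refine lt_of_le_of_lt (norm_integral_le_of_norm_le_const
    (Eventually.of_forall fun x => (hy x).le)) ?_
  rw [div_mul_eq_mul_div, div_lt_iff₀ hpos]
  nlinarith

theorem norm_integral_translate_le {E : Type*} [NormedAddCommGroup E] [NormedSpace ℝ E]
    {f : G → E} {C : ℝ} (hb : ∀ x, ‖f x‖ ≤ C) (a : Measure G) [IsFiniteMeasure a] (y : G) :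
    ‖∫ x, f (x * y) ∂a‖ ≤ C * a.real univ :=
  norm_integral_le_of_norm_le_const (Eventually.of_forall fun _ => hb _)

/-- The convolution of two finite positive measures, by the Riesz representation theorem. -/
theorem exists_positive_conv (a b : Measure G) [IsFiniteMeasure a] [IsFiniteMeasure b] :
    ∃ ρ : Measure G, IsFiniteMeasure ρ ∧ ρ.Regular ∧
      ∀ f : C_c(G, ℝ), ∫ z, f z ∂ρ = ∫ y, ∫ x, f (x * y) ∂a ∂b := by
  have hz : ∀ f : C_c(G, ℝ), Tendsto f (cocompact G) (𝓝 0) := fun f =>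
    f.hasCompactSupport.is_zero_at_infty
  have hint : ∀ (f : C_c(G, ℝ)) (y : G), Integrable (fun x => f (x * y)) a := fun f y => by
    obtain ⟨C, -, hb⟩ := zeroAtInfty_bdd (map_continuous f) (hz f)
    exact integrable_of_cont_bdd (by fun_prop) (fun x => hb _) a
  have hint2 : ∀ (f : C_c(G, ℝ)), Integrable (fun y => ∫ x, f (x * y) ∂a) b := fun f => by
    obtain ⟨C, -, hb⟩ := zeroAtInfty_bdd (map_continuous f) (hz f)
    exact integrable_of_cont_bdd (continuous_integral_translate (map_continuous f) (hz f) a)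
      (norm_integral_translate_le hb a) b
  let L : C_c(G, ℝ) →ₗ[ℝ] ℝ :=
    { toFun := fun f => ∫ y, ∫ x, f (x * y) ∂a ∂b
      map_add' := fun f g => by
        simp only [CompactlySupportedContinuousMap.add_apply]
        rw [← integral_add (hint2 f) (hint2 g)]
        exact integral_congr_ae (Eventually.of_forall fun y => integral_add (hint f y) (hint g y))
      map_smul' := fun c f => by
        simp only [CompactlySupportedContinuousMap.smul_apply, integral_smul, RingHom.id_apply] }
  let Λ : C_c(G, ℝ) →ₚ[ℝ] ℝ := PositiveLinearMap.mk₀ L fun f hf =>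
    integral_nonneg fun y => integral_nonneg fun x => hf _
  refine ⟨RealRMK.rieszMeasure Λ, ⟨?_⟩, inferInstance, fun f => RealRMK.integral_rieszMeasure Λ f⟩
  rw [isOpen_univ.measure_eq_iSup_isCompact]
  refine lt_of_le_of_lt (b := ENNReal.ofReal (a.real univ * b.real univ)) ?_ ENNReal.ofReal_lt_top
  refine iSup₂_le fun K _ => iSup_le fun hK => ?_
  obtain ⟨u, hu1, -, huc, hu⟩ := exists_continuous_one_zero_of_isCompact hK isClosed_empty
    (disjoint_empty K)
  refine (RealRMK.rieszMeasure_le_of_eq_one Λ (f := ⟨u, huc⟩) (fun x => (hu x).1) hK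
    (fun x hx => hu1 hx)).trans (ENNReal.ofReal_le_ofReal ?_)
  have hb : ∀ x, ‖u x‖ ≤ 1 := fun x => by
    rw [Real.norm_of_nonneg (hu x).1]; exact (hu x).2
  refine (le_abs_self _).trans ?_
  have hb2 : ∀ y, ‖∫ x, u (x * y) ∂a‖ ≤ a.real univ := fun y => by
    simpa using norm_integral_translate_le (f := u) hb a y
  exact norm_integral_le_of_norm_le_const (μ := b) (Eventually.of_forall hb2)

theorem positive_conv_zeroAtInfty {a b ρ : Measure G} [IsFiniteMeasure a] [IsFiniteMeasure b]
    [IsFiniteMeasure ρ] (h : ∀ f : C_c(G, ℝ), ∫ z, f z ∂ρ = ∫ y, ∫ x, f (x * y) ∂a ∂b)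
    {f : G → ℝ} (hf : Continuous f) (h0 : Tendsto f (cocompact G) (𝓝 0)) :
    ∫ z, f z ∂ρ = ∫ y, ∫ x, f (x * y) ∂a ∂b := by
  obtain ⟨C, hC, hb⟩ := zeroAtInfty_bdd hf h0
  refine eq_of_abs_sub_le_all fun δ hδ => ?_
  set M := ρ.real univ + a.real univ * b.real univ + 1 with hM
  have hMpos : 0 < M := by positivity
  set ε := δ / M with hε
  have hεpos : 0 < ε := div_pos hδ hMpos
  obtain ⟨K, hK, hKf⟩ := mem_cocompact.1 (h0 (Metric.ball_mem_nhds 0 hεpos))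
  obtain ⟨u, hu1, -, huc, hu⟩ := exists_continuous_one_zero_of_isCompact hK isClosed_empty
    (disjoint_empty K)
  let k : C_c(G, ℝ) := ⟨⟨fun x => u x * f x, by fun_prop⟩, huc.mul_right⟩
  have hk : ∀ x, k x = u x * f x := fun x => rfl
  have hd : ∀ x, ‖f x - k x‖ ≤ ε := fun x => by
    by_cases hx : x ∈ K
    · have : u x = 1 := hu1 hx
      simp [hk, this, hεpos.le]
    · have h1 : ‖f x‖ < ε := by simpa using hKf hx
      have h2 := hu x
      have : f x - k x = (1 - u x) * f x := by rw [hk]; ring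
      rw [this, norm_mul, Real.norm_of_nonneg (by linarith [h2.2])]
      nlinarith [norm_nonneg (f x), h2.1]
  obtain ⟨D, hD, hbk⟩ := zeroAtInfty_bdd (map_continuous k) k.hasCompactSupport.is_zero_at_infty
  have e1 : |∫ z, f z ∂ρ - ∫ z, k z ∂ρ| ≤ ε * ρ.real univ := by
    rw [← integral_sub (integrable_of_cont_bdd hf hb ρ)
      (integrable_of_cont_bdd (map_continuous k) hbk ρ)]
    exact norm_integral_le_of_norm_le_const (Eventually.of_forall hd)
  have e2 : |(∫ y, ∫ x, f (x * y) ∂a ∂b) - ∫ y, ∫ x, k (x * y) ∂a ∂b|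
      ≤ (ε * a.real univ) * b.real univ := by
    rw [← integral_sub
      (integrable_of_cont_bdd (continuous_integral_translate hf h0 a)
        (norm_integral_translate_le hb a) b)
      (integrable_of_cont_bdd (continuous_integral_translate (map_continuous k)
        k.hasCompactSupport.is_zero_at_infty a) (norm_integral_translate_le hbk a) b)]
    have hd2 : ∀ y, ‖(∫ x, f (x * y) ∂a) - ∫ x, k (x * y) ∂a‖ ≤ ε * a.real univ := fun y => by
      rw [← integral_sub (integrable_of_cont_bdd (by fun_prop) (fun x => hb _) a)
        (integrable_of_cont_bdd (by fun_prop) (fun x => hbk _) a)]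
      exact norm_integral_le_of_norm_le_const (Eventually.of_forall fun x => hd _)
    exact norm_integral_le_of_norm_le_const (μ := b) (Eventually.of_forall hd2)
  rw [h k] at e1
  rw [abs_sub_comm] at e2
  refine (abs_sub_le _ _ _).trans ((add_le_add e1 e2).trans ?_)
  have : ε * M = δ := div_mul_cancel₀ _ hMpos.ne'
  nlinarith

theorem positive_conv_complex {a b ρ : Measure G} [IsFiniteMeasure a] [IsFiniteMeasure b]
    [IsFiniteMeasure ρ] (h : ∀ f : C_c(G, ℝ), ∫ z, f z ∂ρ = ∫ y, ∫ x, f (x * y) ∂a ∂b)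
    (g : C₀(G, ℂ)) : ∫ z, g z ∂ρ = ∫ y, ∫ x, g (x * y) ∂a ∂b := by
  have hg : Continuous (g : G → ℂ) := map_continuous g
  have h0 := zero_at_infty g
  obtain ⟨C, hC, hb⟩ := zeroAtInfty_bdd hg h0
  have i1 := integrable_of_cont_bdd hg hb ρ
  have i2 : ∀ y, Integrable (fun x => g (x * y)) a := fun y =>
    integrable_of_cont_bdd (by fun_prop) (fun x => hb _) a
  have i3 : Integrable (fun y => ∫ x, g (x * y) ∂a) b :=
    integrable_of_cont_bdd (continuous_integral_translate hg h0 a)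
        (norm_integral_translate_le hb a) b
  have key : ∀ L : ℂ →L[ℝ] ℝ, L (∫ z, g z ∂ρ) = L (∫ y, ∫ x, g (x * y) ∂a ∂b) := fun L => by
    rw [← L.integral_comp_comm i1, ← L.integral_comp_comm i3]
    simp_rw [fun y => (L.integral_comp_comm (i2 y)).symm]
    refine positive_conv_zeroAtInfty h (f := fun x => L (g x)) (by fun_prop) ?_
    have := (L.continuous.tendsto 0).comp h0
    simpa [Function.comp_def] using this
  exact Complex.ext (key Complex.reCLM) (key Complex.imCLM)

/-- The complex measure `c • a` for a finite positive measure `a` and `c ∈ ℂ`. -/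
noncomputable def toCM (a : Measure G) [IsFiniteMeasure a] (c : ℂ) : ComplexMeasure G :=
  a.toSignedMeasure.mapRange (LinearMap.toSpanSingleton ℝ ℂ c).toAddMonoidHom
    (ContinuousLinearMap.toSpanSingleton ℝ c).continuous

theorem toCM_apply (a : Measure G) [IsFiniteMeasure a] (c : ℂ) {s : Set G} (hs : MeasurableSet s) :
    toCM a c s = (a.real s : ℂ) * c := by
  change a.toSignedMeasure s • c = _
  rw [Measure.toSignedMeasure_apply_measurable hs, Complex.real_smul]

theorem variation_toCM_le (a : Measure G) [IsFiniteMeasure a] (c : ℂ) :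
    (toCM a c).variation ≤ ‖c‖₊ • a := by
  refine VectorMeasure.variation_le_of_forall_enorm_le fun E hE => ?_
  have h : ‖((a.real E : ℝ) : ℂ)‖ₑ = a E := by
    rw [← ofReal_norm, Complex.norm_real, Real.norm_of_nonneg measureReal_nonneg,
      ofReal_measureReal]
  rw [toCM_apply a c hE, enorm_mul, h, mul_comm, Measure.smul_apply, ENNReal.smul_def,
    smul_eq_mul, enorm_eq_nnnorm]

theorem integral_toCM (a : Measure G) [IsFiniteMeasure a] (c : ℂ) {f : G → ℂ} (hf : Integrable f a) :
    (toCM a c).integral f (ContinuousLinearMap.mul ℝ ℂ) = (∫ x, f x ∂a) * c := by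
  have hdom : DominatedFinMeasAdditive a ((toCM a c).transpose (ContinuousLinearMap.mul ℝ ℂ))
      (‖ContinuousLinearMap.mul ℝ ℂ‖ * ‖c‖) := by
    have := isFiniteMeasure_variation (toCM a c)
    refine ⟨fun s t hs ht _ _ hd => (dominatedFinMeasAdditive_cbmApplyMeasure (toCM a c)
      (ContinuousLinearMap.mul ℝ ℂ)).1 s t hs ht (measure_ne_top _ _) (measure_ne_top _ _) hd,
      fun s hs _ => ?_⟩
    refine (norm_cbmApplyMeasure_le (toCM a c) (ContinuousLinearMap.mul ℝ ℂ) s).trans (le_of_eq ?_)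
    rw [toCM_apply a c hs, norm_mul, Complex.norm_real, Real.norm_of_nonneg measureReal_nonneg]
    ring
  rw [VectorMeasure.integral_eq_setToFun,
    ← setToFun_congr_measure_of_integrable (‖c‖₊ : ℝ≥0∞) ENNReal.coe_ne_top
      (variation_toCM_le a c) hdom _ f hf]
  refine hf.induction (P := fun f => setToFun a _ hdom f = (∫ x, f x ∂a) * c) ?_ ?_ ?_ ?_
  · intro z s hs hs'
    rw [setToFun_indicator_const hdom hs hs'.ne, integral_indicator_const z hs]
    change z * (toCM a c s) = _
    rw [toCM_apply a c hs]
    simp; ring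
  · intro f g _ hf hg h1 h2
    rw [setToFun_add hdom hf hg, h1, h2, integral_add' hf hg, add_mul]
  · exact isClosed_eq (continuous_setToFun hdom) (continuous_integral.mul continuous_const)
  · intro f g hfg _ h
    rw [← setToFun_congr_ae hdom hfg, h, integral_congr_ae hfg]

/-- Every complex measure is a combination of four finite positive measures. -/
theorem exists_decomp (μ : ComplexMeasure G) : ∃ a₁ a₂ a₃ a₄ : Measure G,
    ∃ _ : IsFiniteMeasure a₁, ∃ _ : IsFiniteMeasure a₂, ∃ _ : IsFiniteMeasure a₃,
    ∃ _ : IsFiniteMeasure a₄,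
    μ = toCM a₁ 1 + toCM a₂ (-1) + (toCM a₃ Complex.I + toCM a₄ (-Complex.I)) := by
  refine ⟨_, _, _, _, (ComplexMeasure.re μ).toJordanDecomposition.posPart_finite,
    (ComplexMeasure.re μ).toJordanDecomposition.negPart_finite,
    (ComplexMeasure.im μ).toJordanDecomposition.posPart_finite,
    (ComplexMeasure.im μ).toJordanDecomposition.negPart_finite, ?_⟩
  ext s hs
  have h1 := SignedMeasure.apply_eq_posPart_real_sub_negPart_real (ComplexMeasure.re μ) hs
  have h2 := SignedMeasure.apply_eq_posPart_real_sub_negPart_real (ComplexMeasure.im μ) hs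
  have e1 : (ComplexMeasure.re μ) s = (μ s).re := rfl
  have e2 : (ComplexMeasure.im μ) s = (μ s).im := rfl
  rw [e1] at h1
  rw [e2] at h2
  simp only [_root_.add_apply, toCM_apply _ _ hs]
  apply Complex.ext <;> simp [h1, h2] <;> ring

theorem vintegrable_of_cont_bdd {f : G → ℂ} (hf : Continuous f) {C : ℝ} (hb : ∀ x, ‖f x‖ ≤ C)
    (μ : ComplexMeasure G) : μ.Integrable f := by
  have := isFiniteMeasure_variation μ
  exact integrable_of_cont_bdd hf hb μ.variation

theorem norm_vintegral_le {f : G → ℂ} {C : ℝ} (hb : ∀ x, ‖f x‖ ≤ C) (μ : ComplexMeasure G) :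
    ‖μ.integral f (ContinuousLinearMap.mul ℝ ℂ)‖ ≤ C * μ.variation.real univ := by
  have := isFiniteMeasure_variation μ
  simpa using VectorMeasure.norm_integral_le_of_norm_le_const (μ := μ)
    (B := ContinuousLinearMap.mul ℝ ℂ) (Eventually.of_forall hb)

theorem continuous_vintegral_translate (g : C₀(G, ℂ)) (μ : ComplexMeasure G) :
    Continuous fun y => μ.integral (fun x => g (x * y)) (ContinuousLinearMap.mul ℝ ℂ) := by
  have hg : Continuous (g : G → ℂ) := map_continuous g
  have h0 := zero_at_infty g
  obtain ⟨C, hC, hb⟩ := zeroAtInfty_bdd hg h0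
  refine continuous_iff_continuousAt.2 fun y₀ => Metric.tendsto_nhds.2 fun ε hε => ?_
  have hpos : 0 < μ.variation.real univ + 1 := by positivity
  filter_upwards [zeroAtInfty_translate_unif hg h0 y₀ (div_pos hε hpos)] with y hy
  rw [dist_eq_norm, ← VectorMeasure.integral_fun_sub
    (vintegrable_of_cont_bdd (by fun_prop) (fun x => hb _) μ)
    (vintegrable_of_cont_bdd (by fun_prop) (fun x => hb _) μ)]
  refine lt_of_le_of_lt (norm_vintegral_le (fun x => (hy x).le) μ) ?_
  rw [div_mul_eq_mul_div, div_lt_iff₀ hpos]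
  nlinarith

theorem vintegrable_vintegral_translate (g : C₀(G, ℂ)) (μ ν : ComplexMeasure G) :
    ν.Integrable fun y => μ.integral (fun x => g (x * y)) (ContinuousLinearMap.mul ℝ ℂ) := by
  obtain ⟨C, hC, hb⟩ := zeroAtInfty_bdd (map_continuous g) (zero_at_infty g)
  exact vintegrable_of_cont_bdd (continuous_vintegral_translate g μ)
    (fun y => norm_vintegral_le (fun x => hb _) μ) ν

variable (G) in
/-- The space `M(G)` of complex regular Borel measures on `G`: those complex measures whose total
variation measure is regular. -/
noncomputable def MeasureAlgebra : Submodule ℂ (ComplexMeasure G) where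
  carrier := {μ | μ.variation.Regular}
  zero_mem' := by
    change (VectorMeasure.variation (0 : ComplexMeasure G)).Regular
    rw [VectorMeasure.variation_zero]
    infer_instance
  add_mem' := fun {μ ν} hμ hν => by
    have := isFiniteMeasure_variation μ
    have := isFiniteMeasure_variation ν
    have h1 : μ.variation.Regular := hμ
    have h2 : ν.variation.Regular := hν
    have h3 : (μ.variation + ν.variation).Regular := inferInstance
    exact regular_of_le VectorMeasure.variation_add_le
  smul_mem' := fun c μ hμ => by
    have h1 : μ.variation.Regular := hμ
    change (VectorMeasure.variation (c • μ)).Regular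
    rw [VectorMeasure.variation_smul]
    infer_instance

/-- The integral `∫ f dμ` of a complex function against a complex measure. -/
noncomputable def cintegral (f : G → ℂ) (μ : ComplexMeasure G) : ℂ :=
  μ.integral f (ContinuousLinearMap.mul ℝ ℂ)

theorem regular_toCM (a : Measure G) [IsFiniteMeasure a] [a.Regular] (c : ℂ) :
    (toCM a c).variation.Regular := regular_of_le (variation_toCM_le a c)

/-- Existence of the convolution: the functional `g ↦ ∫ ∫ g(xy) dμ(x) dν(y)` on `C₀(G)` is
represented by a regular complex Borel measure. -/
theorem exists_conv (μ ν : ComplexMeasure G) : ∃ ρ : MeasureAlgebra G, ∀ g : C₀(G, ℂ),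
    cintegral g ρ = cintegral (fun y => cintegral (fun x => g (x * y)) μ) ν := by
  have hadd : ∀ (f : G → ℂ) (μ₁ μ₂ : ComplexMeasure G), μ₁.Integrable f → μ₂.Integrable f →
      cintegral f (μ₁ + μ₂) = cintegral f μ₁ + cintegral f μ₂ := fun f μ₁ μ₂ h₁ h₂ =>
    VectorMeasure.integral_add_vectorMeasure h₁ h₂
  have hg : ∀ (g : C₀(G, ℂ)) (μ : ComplexMeasure G), μ.Integrable g := fun g μ => by
    obtain ⟨C, hC, hb⟩ := zeroAtInfty_bdd (map_continuous g) (zero_at_infty g)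
    exact vintegrable_of_cont_bdd (map_continuous g) hb μ
  have hgt : ∀ (g : C₀(G, ℂ)) (y : G) (μ : ComplexMeasure G), μ.Integrable (fun x => g (x * y)) :=
    fun g y μ => by
    obtain ⟨C, hC, hb⟩ := zeroAtInfty_bdd (map_continuous g) (zero_at_infty g)
    have := map_continuous g
    exact vintegrable_of_cont_bdd (by fun_prop) (fun x => hb _) μ
  let P : ComplexMeasure G → ComplexMeasure G → Prop := fun μ ν => ∃ ρ : MeasureAlgebra G,
    ∀ g : C₀(G, ℂ), cintegral g ρ = cintegral (fun y => cintegral (fun x => g (x * y)) μ) ν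
  have hbase : ∀ (a b : Measure G) (_ : IsFiniteMeasure a) (_ : IsFiniteMeasure b) (c d : ℂ),
      P (toCM a c) (toCM b d) := fun a b _ _ c d => by
    obtain ⟨ρ, hρ, hr, h⟩ := exists_positive_conv a b
    refine ⟨⟨toCM ρ (c * d), regular_toCM ρ _⟩, fun g => ?_⟩
    have hc := map_continuous g
    obtain ⟨C, hC, hb⟩ := zeroAtInfty_bdd hc (zero_at_infty g)
    have h2 : ∀ y, cintegral (fun x => g (x * y)) (toCM a c) = (∫ x, g (x * y) ∂a) * c := fun y =>
      integral_toCM a c (integrable_of_cont_bdd (by fun_prop) (fun x => hb _) a)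
    have h3 : Integrable (fun y => (∫ x, g (x * y) ∂a) * c) b :=
      (integrable_of_cont_bdd (continuous_integral_translate hc (zero_at_infty g) a)
        (norm_integral_translate_le hb a) b).mul_const c
    simp_rw [h2]
    change (toCM ρ (c * d)).integral g _ = (toCM b d).integral _ _
    rw [integral_toCM _ _ (integrable_of_cont_bdd hc hb ρ), integral_toCM _ _ h3,
      positive_conv_complex h g, integral_mul_const, mul_assoc]
  have hr : ∀ μ ν₁ ν₂, P μ ν₁ → P μ ν₂ → P μ (ν₁ + ν₂) := fun μ ν₁ ν₂ ⟨ρ₁, h₁⟩ ⟨ρ₂, h₂⟩ =>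
    ⟨ρ₁ + ρ₂, fun g => by
      refine Eq.trans ?_ (hadd _ _ _ (vintegrable_vintegral_translate g μ ν₁)
        (vintegrable_vintegral_translate g μ ν₂)).symm
      exact (hadd _ _ _ (hg _ _) (hg _ _)).trans (congrArg₂ _ (h₁ g) (h₂ g))⟩
  have hl : ∀ μ₁ μ₂ ν, P μ₁ ν → P μ₂ ν → P (μ₁ + μ₂) ν := fun μ₁ μ₂ ν ⟨ρ₁, h₁⟩ ⟨ρ₂, h₂⟩ =>
    ⟨ρ₁ + ρ₂, fun g => by
      have h3 : (fun y => cintegral (fun x => g (x * y)) (μ₁ + μ₂)) = fun y =>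
          cintegral (fun x => g (x * y)) μ₁ + cintegral (fun x => g (x * y)) μ₂ :=
        funext fun y => hadd _ _ _ (hgt _ _ _) (hgt _ _ _)
      have h4 : cintegral (fun y => cintegral (fun x => g (x * y)) μ₁ +
          cintegral (fun x => g (x * y)) μ₂) ν = _ :=
        VectorMeasure.integral_fun_add (vintegrable_vintegral_translate g μ₁ ν)
          (vintegrable_vintegral_translate g μ₂ ν)
      rw [h3, h4]
      exact (hadd _ _ _ (hg _ _) (hg _ _)).trans (congrArg₂ _ (h₁ g) (h₂ g))⟩
  change P μ ν
  obtain ⟨a₁, a₂, a₃, a₄, _, _, _, _, hμ⟩ := exists_decomp μ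
  obtain ⟨b₁, b₂, b₃, b₄, _, _, _, _, hν⟩ := exists_decomp ν
  have hB : ∀ (a : Measure G) (_ : IsFiniteMeasure a) (c : ℂ), P (toCM a c) ν := fun a _ c => by
    rw [hν]
    exact hr _ _ _ (hr _ _ _ (hbase _ _ _ _ _ _) (hbase _ _ _ _ _ _))
      (hr _ _ _ (hbase _ _ _ _ _ _) (hbase _ _ _ _ _ _))
  rw [hμ]
  exact hl _ _ _ (hl _ _ _ (hB _ _ _) (hB _ _ _)) (hl _ _ _ (hB _ _ _) (hB _ _ _))

/-- The total variation measure `|μ|` of `μ ∈ M(G)`. -/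
noncomputable abbrev absMeasure (μ : MeasureAlgebra G) : Measure G :=
  (μ : ComplexMeasure G).variation

/-- The convolution `μ ∗ ν` on `M(G)`: the regular complex Borel measure representing the
functional `g ↦ ∫ ∫ g(xy) dμ(x) dν(y)` on `C₀(G)`. -/
noncomputable def conv (μ ν : MeasureAlgebra G) : MeasureAlgebra G :=
  (exists_conv (μ : ComplexMeasure G) (ν : ComplexMeasure G)).choose

theorem cintegral_conv (μ ν : MeasureAlgebra G) (g : C₀(G, ℂ)) :
    cintegral g (conv μ ν) = cintegral (fun y => cintegral (fun x => g (x * y)) μ) ν :=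
  (exists_conv (μ : ComplexMeasure G) (ν : ComplexMeasure G)).choose_spec g

variable (G) in
/-- The bounded families `(f_μ)_μ` with `f_μ ∈ L^∞(|μ|)`, with the norm `sup_μ ‖f_μ‖_{μ,∞}`. -/
abbrev BoundedFamily : Type _ :=
  lp (fun μ : MeasureAlgebra G => Lp ℂ ∞ (absMeasure μ)) ∞

/-- The compatibility condition defining generalised functions: `f_μ = f_ν` holds `|μ|`-almost
everywhere whenever `μ ≪ ν`. -/
def IsCompatible (f : ∀ μ : MeasureAlgebra G, Lp ℂ ∞ (absMeasure μ)) : Prop :=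
  ∀ μ ν : MeasureAlgebra G, absMeasure μ ≪ absMeasure ν → f μ =ᵐ[absMeasure μ] f ν

/-- A compatible family is automatically bounded, so that working inside `BoundedFamily G` does
not restrict the notion of a generalised function. -/
theorem IsCompatible.memℓp {f : ∀ μ : MeasureAlgebra G, Lp ℂ ∞ (absMeasure μ)}
    (hf : IsCompatible f) : Memℓp f ∞ := by
  have hmono : ∀ μ ν : MeasureAlgebra G, absMeasure μ ≪ absMeasure ν → ‖f μ‖ ≤ ‖f ν‖ := by
    intro μ ν h
    rw [Lp.norm_def, Lp.norm_def]
    refine ENNReal.toReal_mono (Lp.eLpNorm_ne_top _) ?_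
    rw [eLpNorm_congr_ae (hf μ ν h), eLpNorm_exponent_top, eLpNorm_exponent_top]
    exact essSup_mono_measure h
  rw [memℓp_infty_iff]
  by_contra hcon
  rw [not_bddAbove_iff] at hcon
  have h1 : ∀ n : ℕ, ∃ μ : MeasureAlgebra G, (n : ℝ) < ‖f μ‖ := fun n => by
    obtain ⟨_, ⟨μ, rfl⟩, h⟩ := hcon n
    exact ⟨μ, h⟩
  choose μ hμ using h1
  have hfin : ∀ n, IsFiniteMeasure (absMeasure (μ n)) := fun n => isFiniteMeasure_variation _
  have hreg : ∀ n, (absMeasure (μ n)).Regular := fun n => (μ n).2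
  obtain ⟨δ, hδ, hδs⟩ := ENNReal.exists_pos_sum_of_countable (ε := 1) one_ne_zero ℕ
  set w : ℕ → ℝ≥0∞ := fun n => δ n / (1 + absMeasure (μ n) univ) with hw
  have hw0 : ∀ n, w n ≠ 0 := fun n => by
    simp only [hw, ne_eq, ENNReal.div_eq_zero_iff, not_or]
    exact ⟨by simpa using (hδ n).ne', by finiteness⟩
  let m : Measure G := Measure.sum fun n => w n • absMeasure (μ n)
  have hm1 : IsFiniteMeasure m := by
    refine ⟨?_⟩
    rw [Measure.sum_apply _ MeasurableSet.univ]
    refine lt_of_le_of_lt (ENNReal.tsum_le_tsum fun n => ?_) (hδs.trans ENNReal.one_lt_top)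
    change (δ n / (1 + absMeasure (μ n) univ) : ℝ≥0∞) * absMeasure (μ n) univ ≤ δ n
    rw [div_eq_mul_inv, mul_assoc]
    refine mul_le_of_le_one_right' ?_
    rw [mul_comm, ← div_eq_mul_inv]
    exact ENNReal.div_le_of_le_mul (by simp)
  have hm2 : m.InnerRegular := inferInstance
  have hm3 : m.Regular := inferInstance
  let M : MeasureAlgebra G := ⟨toCM m 1, regular_toCM m 1⟩
  have hac : ∀ n, absMeasure (μ n) ≪ absMeasure M := fun n => by
    refine Measure.AbsolutelyContinuous.mk fun s hs h => ?_
    have h2 : ‖toCM m 1 s‖ₑ ≤ 0 := (VectorMeasure.enorm_measure_le_variation _ s).trans h.le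
    have h3 : m s = 0 := by
      have h4 : m.real s = 0 := by simpa [toCM_apply m 1 hs] using h2
      exact (measureReal_eq_zero_iff).1 h4
    rw [Measure.sum_apply _ hs, ENNReal.tsum_eq_zero] at h3
    simpa [hw0 n] using h3 n
  obtain ⟨n, hn⟩ := exists_nat_gt ‖f M‖
  exact absurd (hmono _ _ (hac n)) (not_le.2 (hn.trans (hμ n)))

variable (G) in
/-- The space `GL(G)` of generalised functions, with the norm `‖f‖ = sup_μ ‖f_μ‖_{μ,∞}`. -/
noncomputable def GenFun : Submodule ℂ (BoundedFamily G) where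
  carrier := {f | IsCompatible fun μ => f μ}
  zero_mem' := fun μ ν h => by
    have h1 := Lp.coeFn_zero ℂ ∞ (absMeasure μ)
    have h2 := h.ae_le (Lp.coeFn_zero ℂ ∞ (absMeasure ν))
    exact h1.trans (show _ =ᵐ[absMeasure μ] _ from h2).symm
  add_mem' := fun {f g} hf hg μ ν h => by
    have h1 := Lp.coeFn_add (f μ) (g μ)
    have h2 := h.ae_le (Lp.coeFn_add (f ν) (g ν))
    exact h1.trans (((hf μ ν h).add (hg μ ν h)).trans (show _ =ᵐ[absMeasure μ] _ from h2).symm)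
  smul_mem' := fun c f hf μ ν h => by
    have h1 := Lp.coeFn_smul c (f μ)
    have h2 := h.ae_le (Lp.coeFn_smul c (f ν))
    exact h1.trans (((hf μ ν h).const_smul c).trans (show _ =ᵐ[absMeasure μ] _ from h2).symm)

/-- The component `f_μ ∈ L^∞(|μ|)` of a generalised function `f`. -/
noncomputable def component (f : GenFun G) (μ : MeasureAlgebra G) : Lp ℂ ∞ (absMeasure μ) :=
  (f : BoundedFamily G) μ

/-- The pairing `⟨f, ζ⟩ = ∫ f_ζ dζ` through which `GL(G)` is identified with `M(G)^*`. -/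
noncomputable def pairing (f : GenFun G) (ζ : MeasureAlgebra G) : ℂ :=
  cintegral (component f ζ) ζ

/-- `f` vanishes at infinity: for every `ε > 0` there is one compact set `K` such that, for all
`μ ∈ M(G)`, `|f_μ| < ε` holds `|μ|`-almost everywhere off `K`. -/
def VanishesAtInfinity (f : GenFun G) : Prop :=
  ∀ ε : ℝ, 0 < ε → ∃ K : Set G, IsCompact K ∧
    ∀ μ : MeasureAlgebra G, ∀ᵐ x ∂absMeasure μ, x ∉ K → ‖component f μ x‖ < ε

variable (G) in
/-- The subspace `GL₀(G)` of the generalised functions that vanish at infinity. -/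
noncomputable def GenFunZero : Submodule ℂ (GenFun G) where
  carrier := {f | VanishesAtInfinity f}
  zero_mem' := fun ε hε => ⟨∅, isCompact_empty, fun μ => by
    filter_upwards [Lp.coeFn_zero ℂ ∞ (absMeasure μ)] with x hx _
    change ‖(0 : Lp ℂ ∞ (absMeasure μ)) x‖ < ε
    rw [hx]
    simpa using hε⟩
  add_mem' := fun {f g} hf hg ε hε => by
    obtain ⟨K, hK, hK'⟩ := hf (ε / 2) (half_pos hε)
    obtain ⟨L, hL, hL'⟩ := hg (ε / 2) (half_pos hε)
    refine ⟨K ∪ L, hK.union hL, fun μ => ?_⟩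
    filter_upwards [hK' μ, hL' μ, Lp.coeFn_add (component f μ) (component g μ)] with x h1 h2 h3 hx
    rw [mem_union, not_or] at hx
    change ‖(component f μ + component g μ : Lp ℂ ∞ (absMeasure μ)) x‖ < ε
    rw [h3, Pi.add_apply]
    exact (norm_add_le _ _).trans_lt (by linarith [h1 hx.1, h2 hx.2])
  smul_mem' := fun c f hf ε hε => by
    have hc : 0 < ‖c‖ + 1 := by positivity
    obtain ⟨K, hK, hK'⟩ := hf (ε / (‖c‖ + 1)) (div_pos hε hc)
    refine ⟨K, hK, fun μ => ?_⟩
    filter_upwards [hK' μ, Lp.coeFn_smul c (component f μ)] with x h1 h2 hx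
    change ‖(c • component f μ : Lp ℂ ∞ (absMeasure μ)) x‖ < ε
    rw [h2, Pi.smul_apply, norm_smul]
    have h3 := (lt_div_iff₀ hc).1 (h1 hx)
    nlinarith [norm_nonneg (component f μ x)]

/-- `g = fζ`, that is, `⟨g, μ⟩ = ⟨f, ζ ∗ μ⟩` for all `μ ∈ M(G)`. -/
def IsRightAct (f : GenFun G) (ζ : MeasureAlgebra G) (g : GenFun G) : Prop :=
  ∀ μ : MeasureAlgebra G, pairing g μ = pairing f (conv ζ μ)

/-- `g = ζf`, that is, `⟨g, μ⟩ = ⟨f, μ ∗ ζ⟩` for all `μ ∈ M(G)`. -/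
def IsLeftAct (ζ : MeasureAlgebra G) (f : GenFun G) (g : GenFun G) : Prop :=
  ∀ μ : MeasureAlgebra G, pairing g μ = pairing f (conv μ ζ)

/-- `h = m f` for a bounded functional `m` on a subspace `X` of `GL(G)` and `f ∈ X`:
`⟨h, ζ⟩ = ⟨m, fζ⟩` for all `ζ ∈ M(G)`. It is meaningful when `X` contains all the `fζ`. -/
def IsLeftDualAct (X : Submodule ℂ (GenFun G)) (m : StrongDual ℂ X) (f : X) (h : GenFun G) : Prop :=
  ∀ (ζ : MeasureAlgebra G) (g : X), IsRightAct (f : GenFun G) ζ g → pairing h ζ = m g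

/-- `h = f m` for a bounded functional `m` on a subspace `X` of `GL(G)` and `f ∈ X`:
`⟨h, ζ⟩ = ⟨m, ζf⟩` for all `ζ ∈ M(G)`. It is meaningful when `X` contains all the `ζf`. -/
def IsRightDualAct (X : Submodule ℂ (GenFun G)) (f : X) (m : StrongDual ℂ X) (h : GenFun G) : Prop :=
  ∀ (ζ : MeasureAlgebra G) (g : X), IsLeftAct ζ (f : GenFun G) g → pairing h ζ = m g

/-- `X` is left topologically introverted: `X` contains `fζ` for all `f ∈ X`, `ζ ∈ M(G)`, and it
contains `m f` for all `m ∈ X^*`, `f ∈ X`. -/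
def IsLeftIntroverted (X : Submodule ℂ (GenFun G)) : Prop :=
  (∀ (f : X) (ζ : MeasureAlgebra G), ∃! g : X, IsRightAct (f : GenFun G) ζ g) ∧
    ∀ (m : StrongDual ℂ X) (f : X), ∃! h : X, IsLeftDualAct X m f h

/-- `X` is right topologically introverted: `X` contains `ζf` for all `f ∈ X`, `ζ ∈ M(G)`, and it
contains `f m` for all `m ∈ X^*`, `f ∈ X`. -/
def IsRightIntroverted (X : Submodule ℂ (GenFun G)) : Prop :=
  (∀ (f : X) (ζ : MeasureAlgebra G), ∃! g : X, IsLeftAct ζ (f : GenFun G) g) ∧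
    ∀ (m : StrongDual ℂ X) (f : X), ∃! h : X, IsRightDualAct X f m h

/-- `p = m ⊙ n` for functionals in `X^*`: `⟨m ⊙ n, f⟩ = ⟨m, n f⟩` for all `f ∈ X`. -/
def IsArensProduct (X : Submodule ℂ (GenFun G)) (m n p : StrongDual ℂ X) : Prop :=
  ∀ f h : X, IsLeftDualAct X n f h → p f = m h

end Group

end GeneralisedFunctions

/-!
`GL(G)` is the dual of `M(G)`: a bounded linear form `Φ` on `M(G)` restricts to the spaces
`L¹(|μ|) ⊆ M(G)`, on each of which it is given by a bounded density, and these densities form a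
compatible family (`exists_pairing_eq`). Thus `fζ`, `ζf`, `mf` and `fm` exist as elements of
`GL(G)` and are unique there, and what has to be shown is that they vanish at infinity. This
property is expressed through the pairing: `f` vanishes at infinity if and only if for each
`ε > 0` there is a compact set `K` with `|⟨f, μ⟩| ≤ ε ‖μ‖` for all `μ` that do not charge `K`
(`vanishesAtInfinity_iff`).

The link between convolution and compact sets is that the convolution of measures carried by
compact sets `A` and `B` is carried by `A * B` (`absMeasure_conv_compl_eq_zero`); it comes from
the description of the total variation on an open set by integrals of continuous functions
(`variation_real_le_of_norm_vintegral_le`), which also gives `‖μ ∗ ν‖ ≤ ‖μ‖ ‖ν‖`. If `ζ` is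
carried by the compact set `L` and `μ` does not charge `L⁻¹ K`, then `ζ ∗ μ` does not charge `K`.
As every `ζ` is nearly carried by a compact set, `fζ` vanishes at infinity together with `f`
(`CarriedProduct.act_mem_genFunZero`).

For `mf`, let first `f` be carried by a compact set `K`. If `ζ ↦ ⟨m, fζ⟩` did not vanish at
infinity, there would be an `ε > 0` and, one after the other, measures `ζ₁, ζ₂, …` of norm one,
carried by compact sets `L₁, L₂, …` for which the sets `Lᵢ⁻¹ K` are disjoint, with
`|⟨m, f ζᵢ⟩| > ε`. The `f ζᵢ` are carried by the disjoint sets `Lᵢ⁻¹ K`, so that a combination `∑ cᵢ f ζᵢ` with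
`|cᵢ| = 1` has norm at most `‖f‖`, while for suitable `cᵢ` the value of `m` at the sum of `n`
terms exceeds `n ε`. This contradicts the boundedness of `m`
(`CarriedProduct.exists_isCompact_norm_apply_le_of_supportedIn`). A general `f ∈ GL₀(G)` is a norm
limit of compactly carried ones (`exists_supportedIn_norm_sub_le`).

Convolution and opposite convolution are instances of one structure, `CarriedProduct`, for which
the argument is given once. As `f ↦ nf` is a bounded operator on `GL₀(G)`, the Arens product
`m ⊙ n` is its composition with `m`.
-/

namespace GeneralisedFunctions

open MeasureTheory Filter Topology Set
open scoped NNReal ENNReal ZeroAtInfty CompactlySupported Pointwise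

/-! ### Densities of complex measures -/

section Density

variable {X : Type*} [MeasurableSpace X]

/-- The Radon-Nikodym theorem for complex measures. -/
theorem exists_withDensityᵥ_eq {μ : ComplexMeasure X} {τ : Measure X} [IsFiniteMeasure τ]
    (h : μ.variation ≪ τ) : ∃ k : X → ℂ, Integrable k τ ∧ μ = τ.withDensityᵥ k := by
  have hac : ∀ s, MeasurableSet s → τ s = 0 → μ s = 0 := fun s hs h0 => by
    have := (VectorMeasure.enorm_measure_le_variation μ s).trans (h h0).le
    simpa using this
  have hre : τ.withDensityᵥ ((ComplexMeasure.re μ).rnDeriv τ) = ComplexMeasure.re μ :=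
    SignedMeasure.withDensityᵥ_rnDeriv_eq _ _ <| VectorMeasure.AbsolutelyContinuous.mk
      fun s hs h0 => by
        rw [Measure.toENNRealVectorMeasure_apply_measurable hs] at h0
        change (μ s).re = 0
        rw [hac s hs h0, Complex.zero_re]
  have him : τ.withDensityᵥ ((ComplexMeasure.im μ).rnDeriv τ) = ComplexMeasure.im μ :=
    SignedMeasure.withDensityᵥ_rnDeriv_eq _ _ <| VectorMeasure.AbsolutelyContinuous.mk
      fun s hs h0 => by
        rw [Measure.toENNRealVectorMeasure_apply_measurable hs] at h0
        change (μ s).im = 0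
        rw [hac s hs h0, Complex.zero_im]
  have hi := ComplexMeasure.integrable_rnDeriv μ τ
  refine ⟨ComplexMeasure.rnDeriv μ τ, hi, ?_⟩
  ext s hs
  rw [withDensityᵥ_apply hi hs]
  apply Complex.ext
  · have := congrArg (fun ν : SignedMeasure X => ν s) hre
    simp only [withDensityᵥ_apply (SignedMeasure.integrable_rnDeriv _ _) hs] at this
    rw [← RCLike.re_eq_complex_re, ← integral_re hi.integrableOn]
    exact this.symm
  · have := congrArg (fun ν : SignedMeasure X => ν s) him
    simp only [withDensityᵥ_apply (SignedMeasure.integrable_rnDeriv _ _) hs] at this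
    rw [← RCLike.im_eq_complex_im, ← integral_im hi.integrableOn]
    exact this.symm

theorem integrable_enorm_smul {τ : Measure X} {f k : X → ℂ} (hk : Integrable k τ)
    (hf : Integrable f (τ.withDensityᵥ k).variation) :
    Integrable (fun x => ‖k x‖₊ • f x) τ := by
  rw [Measure.variation_withDensityᵥ hk] at hf
  exact (integrable_withDensity_iff_integrable_smul₀ hk.1.nnnorm.aemeasurable).1 hf

/-- A function that is integrable with respect to `|k τ|` has an integrable product with `k`, as
`f k = (‖k‖ f) (k / ‖k‖)`. -/
theorem integrable_mul_of_variation {τ : Measure X} {f k : X → ℂ} (hk : Integrable k τ)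
    (hf : Integrable f (τ.withDensityᵥ k).variation) : Integrable (fun x => f x * k x) τ := by
  have h1 := integrable_enorm_smul hk hf
  have h2 : AEStronglyMeasurable (fun x => k x / ‖k x‖) τ := by
    have h3 : AEMeasurable k τ := hk.1.aemeasurable
    exact AEMeasurable.aestronglyMeasurable (by fun_prop)
  have h4 := h1.bdd_mul (c := 1) h2 (Eventually.of_forall fun x => by
    rw [norm_div, Complex.norm_real, norm_norm]; exact div_self_le_one _)
  refine h4.congr (Eventually.of_forall fun x => ?_)
  by_cases hx : k x = 0
  · simp [hx]
  · have : (‖k x‖ : ℂ) ≠ 0 := by simpa using hx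
    simp only [NNReal.smul_def, coe_nnnorm, Complex.real_smul]
    field_simp

theorem integral_norm_mul_eq {τ : Measure X} {f k : X → ℂ} (hk : Integrable k τ) :
    ∫ x, ‖f x‖ * ‖k x‖ ∂τ = ∫ x, ‖f x‖ ∂(τ.withDensityᵥ k).variation := by
  rw [Measure.variation_withDensityᵥ hk]
  refine Eq.trans ?_ (integral_withDensity_eq_integral_smul₀ hk.1.nnnorm.aemeasurable _).symm
  simp [NNReal.smul_def, mul_comm]

/-- Integration against a complex measure with density `k` is integration of the product with
`k`. -/
theorem vintegral_withDensityᵥ {τ : Measure X} [IsFiniteMeasure τ] {f k : X → ℂ}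
    (hk : Integrable k τ) (hf : Integrable f (τ.withDensityᵥ k).variation) :
    (τ.withDensityᵥ k).integral f (ContinuousLinearMap.mul ℝ ℂ) = ∫ x, f x * k x ∂τ := by
  have hfin := isFiniteMeasure_variation (τ.withDensityᵥ k)
  refine hf.induction (P := fun f => (τ.withDensityᵥ k).integral f (ContinuousLinearMap.mul ℝ ℂ) =
    ∫ x, f x * k x ∂τ) ?_ ?_ ?_ ?_
  · intro c s hs _
    rw [VectorMeasure.integral_eq_setToFun, setToFun_indicator_const _ hs (measure_ne_top _ _)]
    change c * (τ.withDensityᵥ k) s = _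
    rw [withDensityᵥ_apply hk hs, ← integral_const_mul, ← integral_indicator hs]
    refine integral_congr_ae (Eventually.of_forall fun x => ?_)
    by_cases hx : x ∈ s <;> simp [hx]
  · intro f g _ hf hg h1 h2
    rw [VectorMeasure.integral_add hf hg, h1, h2,
      ← integral_add (integrable_mul_of_variation hk hf) (integrable_mul_of_variation hk hg)]
    simp only [Pi.add_apply, add_mul]
  · refine isClosed_eq VectorMeasure.continuous_integral ?_
    refine LipschitzWith.continuous (K := 1) (LipschitzWith.of_dist_le_mul fun f g => ?_)
    have hf := L1.integrable_coeFn f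
    have hg := L1.integrable_coeFn g
    rw [dist_eq_norm, dist_eq_norm, L1.norm_eq_integral_norm, NNReal.coe_one, one_mul,
      ← integral_sub (integrable_mul_of_variation hk hf) (integrable_mul_of_variation hk hg)]
    have h3 : ∫ x, ‖(f - g : X →₁[(τ.withDensityᵥ k).variation] ℂ) x‖
        ∂(τ.withDensityᵥ k).variation = ∫ x, ‖f x - g x‖ ∂(τ.withDensityᵥ k).variation :=
      integral_congr_ae ((Lp.coeFn_sub f g).mono fun x hx => by
        change ‖(f - g : Lp ℂ 1 (τ.withDensityᵥ k).variation) x‖ = _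
        rw [hx, Pi.sub_apply])
    rw [h3, ← integral_norm_mul_eq (f := fun x => f x - g x) hk]
    refine (norm_integral_le_integral_norm _).trans (le_of_eq ?_)
    simp only [← sub_mul, norm_mul]
  · intro f g hfg _ h
    have h1 : ∫ x, g x * k x ∂τ = ∫ x, f x * k x ∂τ := by
      rw [Measure.variation_withDensityᵥ hk] at hfg
      have h2 := (ae_withDensity_iff' hk.1.enorm).1 hfg
      refine integral_congr_ae (h2.mono fun x hx => ?_)
      by_cases h0 : k x = 0
      · simp [h0]
      · simp [hx (by simpa using h0)]
    rw [← VectorMeasure.integral_congr_ae hfg, h, h1]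

/-- A function all of whose set integrals are bounded by `C` times the measure of the set is
bounded by `C` almost everywhere. -/
theorem ae_norm_le_of_norm_setIntegral_le {τ : Measure X} [IsFiniteMeasure τ] {f : X → ℂ}
    (hf : Integrable f τ) {C : ℝ} (hC : 0 ≤ C)
    (h : ∀ s, MeasurableSet s → ‖∫ x in s, f x ∂τ‖ ≤ C * τ.real s) : ∀ᵐ x ∂τ, ‖f x‖ ≤ C := by
  lift C to ℝ≥0 using hC
  have h1 : (τ.withDensityᵥ f).variation ≤ C • τ := by
    refine VectorMeasure.variation_le_of_forall_enorm_le fun s hs => ?_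
    rw [withDensityᵥ_apply hf hs, Measure.smul_apply, ENNReal.smul_def, smul_eq_mul,
      ← ofReal_norm, ← ofReal_measureReal (μ := τ) (s := s), ← ENNReal.ofReal_coe_nnreal,
      ← ENNReal.ofReal_mul C.coe_nonneg]
    exact ENNReal.ofReal_le_ofReal (h s hs)
  rw [Measure.variation_withDensityᵥ hf] at h1
  have h2 := ae_le_of_forall_setLIntegral_le_of_sigmaFinite₀ (μ := τ) (f := fun x => ‖f x‖ₑ)
    (g := fun _ => (C : ℝ≥0∞)) hf.1.enorm fun s hs _ => by
      rw [setLIntegral_const, ← withDensity_apply _ hs]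
      exact h1 s
  filter_upwards [h2] with x hx
  rw [enorm_eq_nnnorm] at hx
  exact_mod_cast hx

/-- Polar decomposition `μ = h |μ|` with `|h| = 1`. -/
theorem exists_polar (μ : ComplexMeasure X) : ∃ h : X → ℂ, Integrable h μ.variation ∧
    (∀ᵐ x ∂μ.variation, ‖h x‖ = 1) ∧ μ = μ.variation.withDensityᵥ h := by
  have := isFiniteMeasure_variation μ
  obtain ⟨h, hi, he⟩ := exists_withDensityᵥ_eq (Measure.AbsolutelyContinuous.refl μ.variation)
  refine ⟨h, hi, ?_, he⟩
  have h1 := Measure.variation_withDensityᵥ hi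
  rw [← he] at h1
  have h2 := ae_eq_of_forall_setLIntegral_eq_of_sigmaFinite₀ (μ := μ.variation)
    (f := fun x => ‖h x‖ₑ) (g := fun _ => 1) hi.1.enorm aemeasurable_const fun s hs _ => by
      rw [setLIntegral_one, ← withDensity_apply _ hs, ← h1]
  filter_upwards [h2] with x hx
  have h3 : (‖h x‖₊ : ℝ≥0∞) = 1 := hx
  have h4 : ‖h x‖₊ = 1 := by exact_mod_cast h3
  simpa using congrArg NNReal.toReal h4

theorem vintegral_smul_vectorMeasure {μ : ComplexMeasure X} {f : X → ℂ} (hf : μ.Integrable f)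
    (c : ℂ) : (c • μ).integral f (ContinuousLinearMap.mul ℝ ℂ) =
      c * μ.integral f (ContinuousLinearMap.mul ℝ ℂ) := by
  have := isFiniteMeasure_variation μ
  obtain ⟨h, hi, -, he⟩ := exists_polar μ
  have hf1 : Integrable f (μ.variation.withDensityᵥ h).variation := by rwa [← he]
  have e : c • μ = μ.variation.withDensityᵥ (c • h) := by rw [withDensityᵥ_smul, ← he]
  have hf2 : Integrable f (μ.variation.withDensityᵥ (c • h)).variation := by
    rw [← e, VectorMeasure.variation_smul]
    exact hf.smul_measure_nnreal
  have h1 := vintegral_withDensityᵥ hi hf1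
  have h2 := vintegral_withDensityᵥ (hi.smul c) hf2
  rw [← he] at h1
  rw [e, h2, h1, ← integral_const_mul]
  refine integral_congr_ae (Eventually.of_forall fun x => ?_)
  simp only [Pi.smul_apply, smul_eq_mul]
  ring

/-! ### The total variation of a regular complex measure on an open set -/

/-- The radial retraction of `ℂ` onto the closed unit disc. -/
noncomputable def discRetraction (z : ℂ) : ℂ := ((max 1 ‖z‖)⁻¹ : ℝ) • z

theorem continuous_discRetraction : Continuous discRetraction := by
  have : ∀ z : ℂ, max 1 ‖z‖ ≠ 0 := fun z => (lt_max_of_lt_left one_pos).ne'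
  unfold discRetraction
  fun_prop (disch := simpa using this)

theorem norm_discRetraction_le (z : ℂ) : ‖discRetraction z‖ ≤ 1 := by
  have h : 0 < max 1 ‖z‖ := lt_max_of_lt_left one_pos
  rw [discRetraction, norm_smul, Real.norm_of_nonneg (by positivity), inv_mul_le_iff₀ h, mul_one]
  exact le_max_right _ _

/-- Retracting onto the disc costs at most a factor `2` in the distance to a point of the disc. -/
theorem norm_discRetraction_sub_le {w : ℂ} (hw : ‖w‖ ≤ 1) (z : ℂ) :
    ‖discRetraction z - w‖ ≤ 2 * ‖w - z‖ := by
  have h1 : ‖discRetraction z - z‖ ≤ ‖w - z‖ := by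
    rcases le_total ‖z‖ 1 with hz | hz
    · simp [discRetraction, max_eq_left hz]
    · have e : discRetraction z - z = ((‖z‖⁻¹ - 1 : ℝ) : ℂ) * z := by
        rw [discRetraction, max_eq_right hz, Complex.real_smul]; push_cast; ring
      have hz0 : 0 < ‖z‖ := one_pos.trans_le hz
      have h2 : ‖z‖⁻¹ ≤ 1 := inv_le_one_of_one_le₀ hz
      rw [e, norm_mul, Complex.norm_real, Real.norm_of_nonpos (by linarith), neg_sub, sub_mul,
        inv_mul_cancel₀ hz0.ne', one_mul]
      have := norm_sub_norm_le z w
      rw [norm_sub_rev] at this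
      linarith
  have h3 : ‖z - w‖ = ‖w - z‖ := norm_sub_rev _ _
  have h4 := norm_sub_le_norm_sub_add_norm_sub (discRetraction z) z w
  linarith

/-- Continuous functions are dense in `L¹(τ)` for a finite regular measure on a locally compact
Hausdorff space; such a space need not be normal. -/
theorem exists_continuous_integral_norm_sub_le [TopologicalSpace X] [LocallyCompactSpace X]
    [T2Space X] [BorelSpace X] {τ : Measure X} [IsFiniteMeasure τ] [τ.Regular] {f : X → ℂ}
    (hf : Integrable f τ) {ε : ℝ} (hε : 0 < ε) :
    ∃ g : X → ℂ, Continuous g ∧ Integrable g τ ∧ ∫ x, ‖f x - g x‖ ∂τ ≤ ε := by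
  have hf1 : MemLp f 1 τ := memLp_one_iff_integrable.2 hf
  have h0 : ∀ (c : ℂ) ⦃s : Set X⦄, MeasurableSet s → τ s < ∞ → ∀ {δ : ℝ≥0∞}, δ ≠ 0 →
      ∃ g : X → ℂ, eLpNorm (g - s.indicator fun _ => c) 1 τ ≤ δ ∧
        (Continuous g ∧ Integrable g τ) := by
    intro c s hs _ δ hδ
    obtain ⟨η, hη, hηδ⟩ := ENNReal.exists_nnreal_pos_mul_lt (a := 2 * ‖c‖ₑ) (b := δ)
      (by finiteness) hδ
    have hη' : (η : ℝ≥0∞) ≠ 0 := by exact_mod_cast hη.ne'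
    obtain ⟨K, hKs, hK, hKc, hKε⟩ := hs.exists_isCompact_isClosed_sdiff_lt
      (μ := τ) (measure_ne_top _ _) hη'
    obtain ⟨V, hKV, hV, -, hVε⟩ := hKc.measurableSet.exists_isOpen_sdiff_lt (μ := τ)
      (measure_ne_top _ _) hη'
    obtain ⟨u, hu1, hu0, -, hu⟩ := exists_continuous_one_zero_of_isCompact hK hV.isClosed_compl
      (disjoint_compl_right_iff_subset.2 hKV)
    have hcont : Continuous fun x => (u x : ℂ) * c := by fun_prop
    refine ⟨fun x => (u x : ℂ) * c, ?_, hcont, ?_⟩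
    · have hb : ∀ x, ‖(u x : ℂ) * c - s.indicator (fun _ => c) x‖ₑ ≤
          (s \ K ∪ V \ K).indicator (fun _ => ‖c‖ₑ) x := fun x => by
        by_cases hxK : x ∈ K
        · have : u x = 1 := hu1 hxK
          simp [hKs hxK, this]
        by_cases hxs : x ∈ s
        · have hxU : x ∈ s \ K := ⟨hxs, hxK⟩
          rw [indicator_of_mem hxs, indicator_of_mem (mem_union_left _ hxU)]
          have e : (u x : ℂ) * c - c = (u x - 1 : ℝ) * c := by push_cast; ring
          have h1 : ‖(u x - 1 : ℝ)‖ ≤ 1 := by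
            rw [Real.norm_of_nonpos (by linarith [(hu x).2])]; linarith [(hu x).1]
          rw [e, ← ofReal_norm, ← ofReal_norm, norm_mul, Complex.norm_real]
          exact ENNReal.ofReal_le_ofReal (mul_le_of_le_one_left (norm_nonneg _) h1)
        by_cases hxV : x ∈ V
        · have hxU : x ∈ V \ K := ⟨hxV, hxK⟩
          rw [indicator_of_notMem hxs, indicator_of_mem (mem_union_right _ hxU), sub_zero]
          have h1 : ‖u x‖ ≤ 1 := by
            rw [Real.norm_of_nonneg (hu x).1]; exact (hu x).2
          rw [← ofReal_norm, ← ofReal_norm, norm_mul, Complex.norm_real]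
          exact ENNReal.ofReal_le_ofReal (mul_le_of_le_one_left (norm_nonneg _) h1)
        · have : u x = 0 := hu0 hxV
          simp [hxs, this]
      rw [eLpNorm_one_eq_lintegral_enorm]
      refine (lintegral_mono hb).trans ?_
      rw [lintegral_indicator ((hs.diff hKc.measurableSet).union
        (hV.measurableSet.diff hKc.measurableSet)), setLIntegral_const]
      refine le_trans ?_ hηδ.le
      calc ‖c‖ₑ * τ (s \ K ∪ V \ K) ≤ ‖c‖ₑ * (η + η) := by
            gcongr
            exact (measure_union_le _ _).trans (add_le_add hKε.le hVε.le)
        _ = η * (2 * ‖c‖ₑ) := by ring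
    · refine Integrable.of_bound hcont.aestronglyMeasurable ‖c‖ (Eventually.of_forall fun x => ?_)
      rw [norm_mul, Complex.norm_real, Real.norm_of_nonneg (hu x).1]
      exact mul_le_of_le_one_left (norm_nonneg _) (hu x).2
  obtain ⟨g, hg, hgc, hgi⟩ := MemLp.induction_dense ENNReal.one_ne_top
    (fun g => Continuous g ∧ Integrable g τ) h0
    (fun _ _ h₁ h₂ => And.intro (Continuous.add h₁.1 h₂.1) (Integrable.add h₁.2 h₂.2))
    (fun _ h₁ => h₁.2.1) hf1 (ENNReal.ofReal_pos.2 hε).ne'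
  refine ⟨g, hgc, hgi, ?_⟩
  refine (integral_norm_eq_lintegral_enorm (hf.sub hgi).1).trans_le ?_
  refine ENNReal.toReal_le_of_le_ofReal hε.le ?_
  rwa [eLpNorm_one_eq_lintegral_enorm] at hg

/-- The total variation of a regular complex measure on an open set `U` is determined by the
integrals of the continuous functions of modulus at most one that vanish off `U`: for the polar
decomposition `μ = k |μ|` with `|k| = 1`, these functions approximate the conjugate of `k` in
`L¹(|μ|)` on a compact set that exhausts `U` up to `ε`. -/
theorem variation_real_le_of_norm_vintegral_le [TopologicalSpace X] [LocallyCompactSpace X]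
    [T2Space X] [BorelSpace X] {μ : ComplexMeasure X} (hμ : μ.variation.Regular) {U : Set X}
    (hU : IsOpen U) {C : ℝ}
    (h : ∀ g : C₀(X, ℂ), (∀ x, ‖g x‖ ≤ 1) → (∀ x ∉ U, g x = 0) →
      ‖μ.integral g (ContinuousLinearMap.mul ℝ ℂ)‖ ≤ C) :
    μ.variation.real U ≤ C := by
  have hfin := isFiniteMeasure_variation μ
  obtain ⟨k, hk, hk1, hke⟩ := exists_polar μ
  refine le_of_forall_pos_le_add fun δ hδ => ?_
  obtain ⟨ε, hε, hεδ⟩ : ∃ ε : ℝ, 0 < ε ∧ 4 * ε ≤ δ := ⟨δ / 4, by positivity, by linarith⟩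
  have hkc : Integrable (fun x => (starRingEnd ℂ) (k x)) μ.variation :=
    hk.congr' (Complex.continuous_conj.comp_aestronglyMeasurable hk.1)
      (Eventually.of_forall fun x => by simp)
  obtain ⟨g₀, hg₀c, hg₀i, hg₀⟩ := exists_continuous_integral_norm_sub_le hkc hε
  obtain ⟨K, hKU, hK, hKc, hKε⟩ := hU.measurableSet.exists_isCompact_isClosed_sdiff_lt
    (μ := μ.variation) (measure_ne_top _ _) (ENNReal.ofReal_pos.2 hε).ne'
  have hKε' : μ.variation.real (U \ K) ≤ ε :=
    ENNReal.toReal_le_of_le_ofReal hε.le hKε.le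
  obtain ⟨u, hu1, hu0, huc, hu⟩ := exists_continuous_one_zero_of_isCompact hK hU.isClosed_compl
    (disjoint_compl_right_iff_subset.2 hKU)
  have hgc : Continuous fun x => (u x : ℂ) * discRetraction (g₀ x) := by
    have := continuous_discRetraction.comp hg₀c
    exact (Complex.continuous_ofReal.comp u.continuous).mul this
  have hgs : HasCompactSupport fun x => (u x : ℂ) * discRetraction (g₀ x) :=
    HasCompactSupport.mul_right (huc.comp_left (g := ((↑) : ℝ → ℂ)) rfl)
  -- The retraction keeps the modulus at most one, the cutoff `u` makes the function vanish off `U`.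
  let g : C₀(X, ℂ) := ⟨⟨_, hgc⟩, hgs.is_zero_at_infty⟩
  have hgx : ∀ x, g x = (u x : ℂ) * discRetraction (g₀ x) := fun x => rfl
  have hun : ∀ x, ‖(u x : ℂ)‖ ≤ 1 := fun x => by
    rw [Complex.norm_real, Real.norm_of_nonneg (hu x).1]; exact (hu x).2
  have hg1 : ∀ x, ‖g x‖ ≤ 1 := fun x => by
    rw [hgx, norm_mul]
    exact mul_le_one₀ (hun x) (norm_nonneg _) (norm_discRetraction_le _)
  have hgU : ∀ x ∉ U, g x = 0 := fun x hx => by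
    have : u x = 0 := hu0 hx
    simp [hgx, this]
  have hgi : Integrable g μ.variation :=
    Integrable.of_bound g.continuous.aestronglyMeasurable 1 (Eventually.of_forall hg1)
  have e1 : μ.integral g (ContinuousLinearMap.mul ℝ ℂ) = ∫ x, g x * k x ∂μ.variation := by
    have h1 : Integrable g (μ.variation.withDensityᵥ k).variation := by rwa [← hke]
    have h2 := vintegral_withDensityᵥ hk h1
    rwa [← hke] at h2
  have hgk : Integrable (fun x => g x * k x) μ.variation :=
    hk.bdd_mul g.continuous.aestronglyMeasurable (Eventually.of_forall hg1)
  have hind : Integrable (U.indicator fun _ => (1 : ℂ)) μ.variation :=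
    (integrable_const _).indicator hU.measurableSet
  have e2 : ∫ x, U.indicator (fun _ => (1 : ℂ)) x ∂μ.variation = (μ.variation.real U : ℂ) := by
    rw [integral_indicator hU.measurableSet]; simp
  have hind2 : Integrable ((U \ K).indicator fun _ => (2 : ℝ)) μ.variation :=
    (integrable_const _).indicator (hU.measurableSet.diff hKc.measurableSet)
  have hbound : ∀ᵐ x ∂μ.variation, ‖g x * k x - U.indicator (fun _ => (1 : ℂ)) x‖ ≤
      2 * ‖(starRingEnd ℂ) (k x) - g₀ x‖ + (U \ K).indicator (fun _ => (2 : ℝ)) x := by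
    filter_upwards [hk1] with x hx
    by_cases hxU : x ∈ U
    · by_cases hxK : x ∈ K
      · have h1 : u x = 1 := hu1 hxK
        have h2 : (starRingEnd ℂ) (k x) * k x = 1 := by
          rw [mul_comm, Complex.mul_conj, Complex.normSq_eq_norm_sq, hx]; simp
        have h3 : g x * k x - 1 = (discRetraction (g₀ x) - (starRingEnd ℂ) (k x)) * k x := by
          rw [sub_mul, h2, hgx, h1]; simp
        have h4 := norm_discRetraction_sub_le (w := (starRingEnd ℂ) (k x)) (by simp [hx]) (g₀ x)
        have h5 : x ∉ U \ K := fun h => h.2 hxK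
        rw [indicator_of_mem hxU, indicator_of_notMem h5, add_zero, h3, norm_mul, hx, mul_one]
        exact h4
      · have h1 : ‖g x * k x - 1‖ ≤ 2 := by
          refine (norm_sub_le _ _).trans ?_
          rw [norm_mul, hx, norm_one]
          linarith [hg1 x]
        have h2 : x ∈ U \ K := ⟨hxU, hxK⟩
        rw [indicator_of_mem hxU, indicator_of_mem h2]
        linarith [norm_nonneg ((starRingEnd ℂ) (k x) - g₀ x)]
    · have h2 : x ∉ U \ K := fun h => hxU h.1
      rw [indicator_of_notMem hxU, indicator_of_notMem h2, hgU x hxU]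
      simp
  have hsum : ‖∫ x, g x * k x ∂μ.variation - (μ.variation.real U : ℂ)‖ ≤ 2 * ε + 2 * ε := by
    rw [← e2, ← integral_sub hgk hind]
    refine (norm_integral_le_of_norm_le ((hkc.sub hg₀i).norm.const_mul 2 |>.add hind2)
      hbound).trans ?_
    have e3 : ∫ x, (U \ K).indicator (fun _ => (2 : ℝ)) x ∂μ.variation =
        2 * μ.variation.real (U \ K) := by
      rw [integral_indicator (hU.measurableSet.diff hKc.measurableSet)]
      simp [mul_comm]
    rw [integral_add' ((hkc.sub hg₀i).norm.const_mul 2) hind2, e3, integral_const_mul]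
    have : ∫ x, ‖((fun x => (starRingEnd ℂ) (k x)) - g₀) x‖ ∂μ.variation ≤ ε := hg₀
    linarith
  have h1 := h g hg1 hgU
  rw [e1] at h1
  have h2 := norm_sub_norm_le (μ.variation.real U : ℂ) (∫ x, g x * k x ∂μ.variation)
  rw [norm_sub_rev] at h2
  rw [Complex.norm_real, Real.norm_of_nonneg measureReal_nonneg] at h2
  linarith

end Density

/-! ### Elements of `M(G)` given by densities, and restrictions -/

/-- A finite measure `τ ≪ ω` inherits regularity: a Borel set is, up to an `ω`-null set, a countable
union of compact sets, so it has compact subsets of nearly full `τ`-measure. -/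
theorem regular_of_absolutelyContinuous {X : Type*} [MeasurableSpace X] [TopologicalSpace X]
    [BorelSpace X] [R1Space X] {τ ω : Measure X} [IsFiniteMeasure τ] [IsFiniteMeasure ω]
    [ω.Regular] (h : τ ≪ ω) : τ.Regular := by
  have : τ.InnerRegular := ⟨fun A hA r hr => by
    have h1 : ∀ n : ℕ, ∃ K ⊆ A, IsCompact K ∧ IsClosed K ∧ ω (A \ K) < (n + 1 : ℝ≥0∞)⁻¹ :=
      fun n => hA.exists_isCompact_isClosed_sdiff_lt (measure_ne_top _ _) (by simp)
    choose K hKA hK _ hKω using h1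
    have h2 : ω (A \ ⋃ n, K n) = 0 := by
      refine le_antisymm (le_of_forall_pos_le_add fun ε hε => ?_) zero_le
      obtain ⟨n, hn⟩ := ENNReal.exists_inv_nat_lt hε.ne'
      rw [zero_add]
      refine (measure_mono (sdiff_subset_sdiff_right (subset_iUnion K n))).trans
        ((hKω n).le.trans (le_trans ?_ hn.le))
      gcongr
      exact le_self_add
    have h3 : τ A ≤ τ (⋃ n, K n) := by
      have := measure_union_le (μ := τ) (⋃ n, K n) (A \ ⋃ n, K n)
      rw [h h2, add_zero] at this
      exact (measure_mono (by simp)).trans this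
    rw [measure_iUnion_eq_iSup_accumulate] at h3
    obtain ⟨n, hn⟩ := lt_iSup_iff.1 (hr.trans_le h3)
    exact ⟨_, iUnion₂_subset fun i _ => hKA i, isCompact_accumulate hK n, hn⟩⟩
  infer_instance

section Group

variable {G : Type*} [Group G] [TopologicalSpace G] [IsTopologicalGroup G]
  [LocallyCompactSpace G] [T2Space G] [MeasurableSpace G] [BorelSpace G]

instance instIsFiniteMeasureVariation (μ : ComplexMeasure G) : IsFiniteMeasure μ.variation :=
  isFiniteMeasure_variation μ

instance instRegularAbsMeasure (μ : MeasureAlgebra G) : (absMeasure μ).Regular := μ.2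

/-- The norm `|μ|(G)` of `μ ∈ M(G)`. -/
noncomputable def totalVar (μ : MeasureAlgebra G) : ℝ := (absMeasure μ).real univ

theorem totalVar_nonneg (μ : MeasureAlgebra G) : 0 ≤ totalVar μ := measureReal_nonneg

theorem totalVar_eq_zero {μ : MeasureAlgebra G} (h : totalVar μ = 0) : μ = 0 := by
  have h1 : absMeasure μ = 0 := by
    rwa [totalVar, measureReal_eq_zero_iff, Measure.measure_univ_eq_zero] at h
  exact Subtype.ext (VectorMeasure.variation_eq_zero.1 h1)

/-- The element `k ω` of `M(G)`, for a finite regular measure `ω` and `k ∈ L¹(ω)`; it is `0` when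
`k` is not integrable. -/
noncomputable def ofDensity (ω : Measure G) [IsFiniteMeasure ω] [ω.Regular] (k : G → ℂ) :
    MeasureAlgebra G :=
  ⟨ω.withDensityᵥ k, by
    by_cases hk : Integrable k ω
    · refine regular_of_absolutelyContinuous (ω := ω) ?_
      rw [Measure.variation_withDensityᵥ hk]
      exact withDensity_absolutelyContinuous _ _
    · rw [Measure.withDensityᵥ, dif_neg hk]
      exact (0 : MeasureAlgebra G).2⟩

section ofDensity

variable {ω : Measure G} [IsFiniteMeasure ω] [ω.Regular] {k l : G → ℂ}

theorem coe_ofDensity : (ofDensity ω k : ComplexMeasure G) = ω.withDensityᵥ k := rfl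

theorem absMeasure_ofDensity (hk : Integrable k ω) :
    absMeasure (ofDensity ω k) = ω.withDensity fun x => ‖k x‖ₑ :=
  Measure.variation_withDensityᵥ hk

theorem absMeasure_ofDensity_ac : absMeasure (ofDensity ω k) ≪ ω := by
  by_cases hk : Integrable k ω
  · rw [absMeasure_ofDensity hk]
    exact withDensity_absolutelyContinuous _ _
  · have : ofDensity ω k = 0 := Subtype.ext (by
      rw [coe_ofDensity, Measure.withDensityᵥ, dif_neg hk]; rfl)
    rw [this]
    change VectorMeasure.variation (0 : ComplexMeasure G) ≪ ω
    rw [VectorMeasure.variation_zero]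
    exact Measure.AbsolutelyContinuous.zero _

theorem totalVar_ofDensity (hk : Integrable k ω) : totalVar (ofDensity ω k) = ∫ x, ‖k x‖ ∂ω := by
  rw [totalVar, absMeasure_ofDensity hk, measureReal_def, withDensity_apply _ MeasurableSet.univ,
    Measure.restrict_univ, integral_norm_eq_lintegral_enorm hk.1]

theorem ofDensity_add (hk : Integrable k ω) (hl : Integrable l ω) :
    ofDensity ω (k + l) = ofDensity ω k + ofDensity ω l :=
  Subtype.ext (withDensityᵥ_add hk hl)

theorem ofDensity_sub (hk : Integrable k ω) (hl : Integrable l ω) :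
    ofDensity ω (k - l) = ofDensity ω k - ofDensity ω l :=
  Subtype.ext (withDensityᵥ_sub hk hl)

theorem ofDensity_smul (c : ℂ) : ofDensity ω (c • k) = c • ofDensity ω k :=
  Subtype.ext (withDensityᵥ_smul k c)

theorem ofDensity_congr (h : k =ᵐ[ω] l) : ofDensity ω k = ofDensity ω l :=
  Subtype.ext (WithDensityᵥEq.congr_ae h)

end ofDensity

/-- The regular measure `ω` itself, as an element of `M(G)`. -/
noncomputable def ofMeasure (ω : Measure G) [IsFiniteMeasure ω] [ω.Regular] : MeasureAlgebra G :=
  ofDensity ω 1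

theorem absMeasure_ofMeasure (ω : Measure G) [IsFiniteMeasure ω] [ω.Regular] :
    absMeasure (ofMeasure ω) = ω := by
  have h1 : Integrable (1 : G → ℂ) ω := integrable_const 1
  rw [ofMeasure, absMeasure_ofDensity h1]
  simp

theorem exists_ofDensity_eq {μ : MeasureAlgebra G} {ω : Measure G} [IsFiniteMeasure ω] [ω.Regular]
    (h : absMeasure μ ≪ ω) : ∃ k : G → ℂ, Integrable k ω ∧ μ = ofDensity ω k := by
  obtain ⟨k, hk, hμ⟩ := exists_withDensityᵥ_eq h
  exact ⟨k, hk, Subtype.ext hμ⟩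

/-- Restriction of the elements of `M(G)` to a Borel set `A`; it is `0` when `A` is not Borel. -/
noncomputable def restrictTo (A : Set G) : MeasureAlgebra G →ₗ[ℂ] MeasureAlgebra G :=
  ((VectorMeasure.restrictₗ (R := ℂ) A).comp (MeasureAlgebra G).subtype).codRestrict _ fun μ =>
    regular_of_le (ρ := absMeasure μ)
      (VectorMeasure.variation_restrict_le.trans Measure.restrict_le_self)

theorem coe_restrictTo (A : Set G) (μ : MeasureAlgebra G) :
    (restrictTo A μ : ComplexMeasure G) = (μ : ComplexMeasure G).restrict A := rfl

theorem absMeasure_restrictTo {A : Set G} (hA : MeasurableSet A) (μ : MeasureAlgebra G) :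
    absMeasure (restrictTo A μ) = (absMeasure μ).restrict A :=
  VectorMeasure.variation_restrict hA

theorem totalVar_restrictTo {A : Set G} (hA : MeasurableSet A) (μ : MeasureAlgebra G) :
    totalVar (restrictTo A μ) = (absMeasure μ).real A := by
  rw [totalVar, absMeasure_restrictTo hA, measureReal_restrict_apply_univ]

theorem absMeasure_restrictTo_compl {A : Set G} (hA : MeasurableSet A) (μ : MeasureAlgebra G) :
    absMeasure (restrictTo A μ) Aᶜ = 0 := by
  rw [absMeasure_restrictTo hA, Measure.restrict_apply hA.compl]; simp

theorem absMeasure_restrictTo_null {A : Set G} (hA : MeasurableSet A) (μ : MeasureAlgebra G)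
    {B : Set G} (hB : Disjoint A B) : absMeasure (restrictTo A μ) B = 0 :=
  measure_mono_null hB.subset_compl_left (absMeasure_restrictTo_compl hA μ)

theorem restrictTo_add_compl {A : Set G} (hA : MeasurableSet A) (μ : MeasureAlgebra G) :
    restrictTo A μ + restrictTo Aᶜ μ = μ :=
  Subtype.ext (VectorMeasure.restrict_add_restrict_compl hA)

theorem totalVar_restrictTo_add_compl {A : Set G} (hA : MeasurableSet A) (μ : MeasureAlgebra G) :
    totalVar (restrictTo A μ) + totalVar (restrictTo Aᶜ μ) = totalVar μ := by
  rw [totalVar_restrictTo hA, totalVar_restrictTo hA.compl, totalVar,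
    measureReal_add_measureReal_compl hA]

theorem totalVar_restrictTo_le {A : Set G} (hA : MeasurableSet A) (μ : MeasureAlgebra G) :
    totalVar (restrictTo A μ) ≤ totalVar μ := by
  linarith [totalVar_restrictTo_add_compl hA μ, totalVar_nonneg (restrictTo Aᶜ μ)]

theorem restrictTo_union {A B : Set G} (hA : MeasurableSet A) (hB : MeasurableSet B)
    (h : Disjoint A B) (μ : MeasureAlgebra G) :
    restrictTo (A ∪ B) μ = restrictTo A μ + restrictTo B μ :=
  Subtype.ext (VectorMeasure.restrict_union h hA hB)

theorem restrictTo_ofMeasure {A : Set G} (hA : MeasurableSet A) (ω : Measure G)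
    [IsFiniteMeasure ω] [ω.Regular] :
    restrictTo A (ofMeasure ω) = ofDensity ω (A.indicator 1) := by
  refine Subtype.ext (VectorMeasure.ext fun s hs => ?_)
  have h1 : Integrable (1 : G → ℂ) ω := integrable_const 1
  rw [coe_restrictTo, VectorMeasure.restrict_apply _ hA hs, ofMeasure, coe_ofDensity,
    coe_ofDensity, withDensityᵥ_apply h1 (hs.inter hA), withDensityᵥ_apply (h1.indicator hA) hs,
    setIntegral_indicator hA]

/-! ### Linearity of the integral and of the pairing -/

theorem cintegral_add_measure {f : G → ℂ} {μ ν : ComplexMeasure G} (hμ : μ.Integrable f)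
    (hν : ν.Integrable f) : cintegral f (μ + ν) = cintegral f μ + cintegral f ν :=
  VectorMeasure.integral_add_vectorMeasure hμ hν

theorem cintegral_smul_measure {f : G → ℂ} {μ : ComplexMeasure G} (hμ : μ.Integrable f) (c : ℂ) :
    cintegral f (c • μ) = c * cintegral f μ :=
  vintegral_smul_vectorMeasure hμ c

theorem cintegral_ofDensity {ω : Measure G} [IsFiniteMeasure ω] [ω.Regular] {f k : G → ℂ}
    (hk : Integrable k ω) (hf : Integrable f (absMeasure (ofDensity ω k))) :
    cintegral f (ofDensity ω k) = ∫ x, f x * k x ∂ω :=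
  vintegral_withDensityᵥ hk hf

theorem component_ae_eq (f : GenFun G) {μ ν : MeasureAlgebra G} (h : absMeasure μ ≪ absMeasure ν) :
    component f μ =ᵐ[absMeasure μ] component f ν :=
  f.2 μ ν h

theorem integrable_component (f : GenFun G) {μ ν : MeasureAlgebra G}
    (h : absMeasure μ ≪ absMeasure ν) : Integrable (component f ν) (absMeasure μ) :=
  ((Lp.memLp (component f μ)).integrable le_top).congr (component_ae_eq f h)

/-- The pairing can be computed with the component of any measure that dominates `μ`. -/
theorem pairing_eq_of_ac (f : GenFun G) {μ ν : MeasureAlgebra G}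
    (h : absMeasure μ ≪ absMeasure ν) : pairing f μ = cintegral (component f ν) μ :=
  VectorMeasure.integral_congr_ae (component_ae_eq f h)

theorem pairing_ofDensity (f : GenFun G) (ν : MeasureAlgebra G) {k : G → ℂ}
    (hk : Integrable k (absMeasure ν)) :
    pairing f (ofDensity (absMeasure ν) k) = ∫ x, component f ν x * k x ∂absMeasure ν := by
  rw [pairing_eq_of_ac f absMeasure_ofDensity_ac,
    cintegral_ofDensity hk (integrable_component f absMeasure_ofDensity_ac)]

theorem absMeasure_ac_ofMeasure_add_left (μ ν : MeasureAlgebra G) :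
    absMeasure μ ≪ absMeasure (ofMeasure (absMeasure μ + absMeasure ν)) := by
  rw [absMeasure_ofMeasure]
  exact (Measure.le_add_right le_rfl).absolutelyContinuous

theorem absMeasure_ac_ofMeasure_add_right (μ ν : MeasureAlgebra G) :
    absMeasure ν ≪ absMeasure (ofMeasure (absMeasure μ + absMeasure ν)) := by
  rw [absMeasure_ofMeasure]
  exact (Measure.le_add_left le_rfl).absolutelyContinuous

theorem pairing_add_right (f : GenFun G) (μ ν : MeasureAlgebra G) :
    pairing f (μ + ν) = pairing f μ + pairing f ν := by
  have h1 := absMeasure_ac_ofMeasure_add_left μ ν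
  have h2 := absMeasure_ac_ofMeasure_add_right μ ν
  have h3 : absMeasure (μ + ν) ≪ absMeasure (ofMeasure (absMeasure μ + absMeasure ν)) := by
    rw [absMeasure_ofMeasure]
    exact Measure.absolutelyContinuous_of_le VectorMeasure.variation_add_le
  rw [pairing_eq_of_ac f h1, pairing_eq_of_ac f h2, pairing_eq_of_ac f h3]
  exact cintegral_add_measure (integrable_component f h1) (integrable_component f h2)

theorem pairing_smul_right (f : GenFun G) (c : ℂ) (μ : MeasureAlgebra G) :
    pairing f (c • μ) = c * pairing f μ := by
  have h3 : absMeasure (c • μ) ≪ absMeasure μ := by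
    change VectorMeasure.variation (c • (μ : ComplexMeasure G)) ≪ _
    rw [VectorMeasure.variation_smul]
    exact Measure.smul_absolutelyContinuous
  rw [pairing_eq_of_ac f h3]
  exact cintegral_smul_measure (integrable_component f (Measure.AbsolutelyContinuous.refl _)) c

theorem pairing_add_left (f g : GenFun G) (μ : MeasureAlgebra G) :
    pairing (f + g) μ = pairing f μ + pairing g μ := by
  have hf := integrable_component f (Measure.AbsolutelyContinuous.refl (absMeasure μ))
  have hg := integrable_component g (Measure.AbsolutelyContinuous.refl (absMeasure μ))
  exact (VectorMeasure.integral_congr_ae (Lp.coeFn_add (component f μ) (component g μ))).trans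
    (VectorMeasure.integral_add hf hg)

theorem pairing_smul_left (c : ℂ) (f : GenFun G) (μ : MeasureAlgebra G) :
    pairing (c • f) μ = c * pairing f μ := by
  obtain ⟨k, hk, -, he⟩ := exists_polar (μ : ComplexMeasure G)
  have he' : μ = ofDensity (absMeasure μ) k := Subtype.ext he
  have h := Lp.coeFn_smul c (component f μ)
  have h1 := pairing_ofDensity (c • f) μ hk
  have h2 := pairing_ofDensity f μ hk
  rw [← he'] at h1 h2
  rw [h1, h2, ← integral_const_mul]
  refine integral_congr_ae (h.mono fun x hx => ?_)
  have hx' : component (c • f) μ x = c * component f μ x := hx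
  simp only [hx', mul_assoc]

/-- The pairing `⟨f, μ⟩` as a linear form in `μ`. -/
noncomputable def pairingₗ (f : GenFun G) : MeasureAlgebra G →ₗ[ℂ] ℂ where
  toFun := pairing f
  map_add' := pairing_add_right f
  map_smul' := pairing_smul_right f

@[simp] theorem pairingₗ_apply (f : GenFun G) (μ : MeasureAlgebra G) :
    pairingₗ f μ = pairing f μ := rfl

/-! ### Norm, vanishing at infinity and the pairing -/

theorem norm_pairing_le_of_ae (f : GenFun G) {μ : MeasureAlgebra G} {C : ℝ}
    (h : ∀ᵐ x ∂absMeasure μ, ‖component f μ x‖ ≤ C) : ‖pairing f μ‖ ≤ C * totalVar μ := by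
  have := VectorMeasure.norm_integral_le_of_norm_le_const (μ := (μ : ComplexMeasure G))
    (B := ContinuousLinearMap.mul ℝ ℂ) h
  simpa [totalVar, pairing, cintegral] using this

theorem ae_norm_component_le (f : GenFun G) (μ : MeasureAlgebra G) :
    ∀ᵐ x ∂absMeasure μ, ‖component f μ x‖ ≤ ‖f‖ := by
  have h1 : ‖component f μ‖ ≤ ‖f‖ := lp.norm_apply_le_norm (by simp) (f : BoundedFamily G) μ
  filter_upwards [ae_le_eLpNormEssSup (f := component f μ) (μ := absMeasure μ)] with x hx
  refine le_trans ?_ h1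
  rw [← eLpNorm_exponent_top] at hx
  rw [Lp.norm_def, ← toReal_enorm]
  exact ENNReal.toReal_mono (Lp.eLpNorm_ne_top _) hx

theorem norm_pairing_le (f : GenFun G) (μ : MeasureAlgebra G) :
    ‖pairing f μ‖ ≤ ‖f‖ * totalVar μ :=
  norm_pairing_le_of_ae f (ae_norm_component_le f μ)

/-- The bound of a generalised function off a Borel set `K` is read off from its pairings with the
measures that do not charge `K`. -/
theorem ae_norm_component_le_of_norm_pairing_le (f : GenFun G) {K : Set G} (hK : MeasurableSet K)
    {C : ℝ} (hC : 0 ≤ C)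
    (h : ∀ μ : MeasureAlgebra G, absMeasure μ K = 0 → ‖pairing f μ‖ ≤ C * totalVar μ)
    (μ : MeasureAlgebra G) : ∀ᵐ x ∂absMeasure μ, x ∉ K → ‖component f μ x‖ ≤ C := by
  have hf := integrable_component f (Measure.AbsolutelyContinuous.refl (absMeasure μ))
  refine (ae_restrict_iff' hK.compl).1 (ae_norm_le_of_norm_setIntegral_le hf.restrict hC
    fun s hs => ?_)
  have hsm : MeasurableSet (s ∩ Kᶜ) := hs.inter hK.compl
  have hk : Integrable ((s ∩ Kᶜ).indicator (1 : G → ℂ)) (absMeasure μ) :=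
    (integrable_const 1).indicator hsm
  have h1 := h (ofDensity (absMeasure μ) ((s ∩ Kᶜ).indicator 1)) (by
    rw [absMeasure_ofDensity hk, withDensity_apply _ hK]
    refine setLIntegral_eq_zero hK fun x hx => ?_
    have : x ∉ s ∩ Kᶜ := fun h => h.2 hx
    simp [indicator_of_notMem this])
  rw [pairing_ofDensity f μ hk, totalVar_ofDensity hk] at h1
  have e1 : ∫ x, component f μ x * (s ∩ Kᶜ).indicator (1 : G → ℂ) x ∂absMeasure μ =
      ∫ x in s, component f μ x ∂(absMeasure μ).restrict Kᶜ := by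
    rw [Measure.restrict_restrict hs, ← integral_indicator hsm]
    refine integral_congr_ae (Eventually.of_forall fun x => ?_)
    by_cases hx : x ∈ s ∩ Kᶜ
    · simp only [indicator_of_mem hx, Pi.one_apply, mul_one]
    · simp only [indicator_of_notMem hx, mul_zero]
  have e2 : ∫ x, ‖(s ∩ Kᶜ).indicator (1 : G → ℂ) x‖ ∂absMeasure μ =
      ((absMeasure μ).restrict Kᶜ).real s := by
    rw [measureReal_restrict_apply hs, ← integral_indicator_one hsm]
    refine integral_congr_ae (Eventually.of_forall fun x => ?_)
    by_cases hx : x ∈ s ∩ Kᶜ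
    · simp only [indicator_of_mem hx, Pi.one_apply, norm_one]
    · simp only [indicator_of_notMem hx, norm_zero]
  rwa [e1, e2] at h1

theorem norm_le_of_norm_pairing_le (f : GenFun G) {C : ℝ} (hC : 0 ≤ C)
    (h : ∀ μ : MeasureAlgebra G, ‖pairing f μ‖ ≤ C * totalVar μ) : ‖f‖ ≤ C := by
  refine lp.norm_le_of_forall_le (f := (f : BoundedFamily G)) hC fun μ => ?_
  have h1 := ae_norm_component_le_of_norm_pairing_le f MeasurableSet.empty hC (fun μ _ => h μ) μ
  have h2 := Lp.norm_le_of_ae_bound (f := component f μ) hC (h1.mono fun x hx => hx (by simp))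
  rw [ENNReal.toReal_top, inv_zero, Real.rpow_zero, one_mul] at h2
  exact h2

/-- A generalised function is determined by its pairings with `M(G)`. -/
theorem GenFun.ext_pairing {f g : GenFun G}
    (h : ∀ μ : MeasureAlgebra G, pairing f μ = pairing g μ) : f = g := by
  rw [← sub_eq_zero, ← norm_le_zero_iff]
  refine norm_le_of_norm_pairing_le _ le_rfl fun μ => ?_
  have e : f - g = f + (-1 : ℂ) • g := by rw [neg_one_smul, sub_eq_add_neg]
  rw [e, pairing_add_left, pairing_smul_left, h]
  simp

/-- Vanishing at infinity, expressed through the pairing. -/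
theorem vanishesAtInfinity_iff (f : GenFun G) : VanishesAtInfinity f ↔ ∀ ε : ℝ, 0 < ε →
    ∃ K : Set G, IsCompact K ∧ ∀ μ : MeasureAlgebra G, absMeasure μ K = 0 →
      ‖pairing f μ‖ ≤ ε * totalVar μ := by
  refine ⟨fun h ε hε => ?_, fun h ε hε => ?_⟩
  · obtain ⟨K, hK, hf⟩ := h ε hε
    refine ⟨K, hK, fun μ hμ => norm_pairing_le_of_ae f ?_⟩
    have h0 : ∀ᵐ x ∂absMeasure μ, x ∉ K := measure_eq_zero_iff_ae_notMem.1 hμ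
    filter_upwards [hf μ, h0] with x h1 h2
    exact (h1 h2).le
  · obtain ⟨K, hK, hf⟩ := h (ε / 2) (half_pos hε)
    refine ⟨K, hK, fun μ => ?_⟩
    filter_upwards [ae_norm_component_le_of_norm_pairing_le f hK.measurableSet
      (half_pos hε).le hf μ] with x hx hxK
    exact (hx hxK).trans_lt (half_lt_self hε)

/-! ### The dual of `M(G)` -/

/-- A bounded linear form on `M(G)` is given on `L¹(ω) ⊆ M(G)` by a bounded density: the
Radon-Nikodym derivative of `E ↦ Φ (ω|_E)`. -/
theorem exists_density_of_bounded (Φ : MeasureAlgebra G →ₗ[ℂ] ℂ) {C : ℝ} (hC : 0 ≤ C)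
    (hΦ : ∀ μ, ‖Φ μ‖ ≤ C * totalVar μ) (ω : Measure G) [IsFiniteMeasure ω] [ω.Regular] :
    ∃ g : G → ℂ, Integrable g ω ∧ (∀ᵐ x ∂ω, ‖g x‖ ≤ C) ∧
      ∀ k : G → ℂ, Integrable k ω → Φ (ofDensity ω k) = ∫ x, g x * k x ∂ω := by
  lift C to ℝ≥0 using hC
  have hmeas : ∀ A, MeasurableSet A → ‖Φ (restrictTo A (ofMeasure ω))‖ ≤ C * ω.real A :=
    fun A hA => by
      simpa only [totalVar_restrictTo hA, absMeasure_ofMeasure] using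
        hΦ (restrictTo A (ofMeasure ω))
  have hnot : ∀ A, ¬MeasurableSet A → Φ (restrictTo A (ofMeasure ω)) = 0 := fun A hA => by
    have : restrictTo A (ofMeasure ω) = 0 :=
      Subtype.ext (VectorMeasure.restrict_not_measurable _ hA)
    rw [this, map_zero]
  have hle : ∀ A, ‖Φ (restrictTo A (ofMeasure ω))‖ₑ ≤ (C • ω) A := fun A => by
    by_cases hA : MeasurableSet A
    · rw [Measure.smul_apply, ENNReal.smul_def, smul_eq_mul, ← ofReal_norm,
        ← ofReal_measureReal (μ := ω) (s := A), ← ENNReal.ofReal_coe_nnreal,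
        ← ENNReal.ofReal_mul C.coe_nonneg]
      exact ENNReal.ofReal_le_ofReal (hmeas A hA)
    · simp [hnot A hA]
  -- Countable additivity of `A ↦ Φ (ω|_A)` follows from its domination by `C ω`.
  let m : ComplexMeasure G := VectorMeasure.of_additive_of_le_measure
    (fun A => Φ (restrictTo A (ofMeasure ω))) hle
    (fun s t hs ht hst => by rw [restrictTo_union hs ht hst, map_add]) hnot
  have hm : ∀ A, m A = Φ (restrictTo A (ofMeasure ω)) := fun A => rfl
  have hmω : m.variation ≪ ω :=
    (Measure.absolutelyContinuous_of_le
      (VectorMeasure.variation_le_of_forall_enorm_le fun A _ => hle A)).trans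
      Measure.smul_absolutelyContinuous
  obtain ⟨g, hg, hmg⟩ := exists_withDensityᵥ_eq hmω
  have hset : ∀ A, MeasurableSet A → Φ (restrictTo A (ofMeasure ω)) = ∫ x in A, g x ∂ω :=
    fun A hA => by rw [← hm, hmg, withDensityᵥ_apply hg hA]
  have hbd : ∀ᵐ x ∂ω, ‖g x‖ ≤ C := ae_norm_le_of_norm_setIntegral_le hg C.coe_nonneg
    fun A hA => by rw [← hset A hA]; exact hmeas A hA
  have hgk : ∀ k : G → ℂ, Integrable k ω → Integrable (fun x => g x * k x) ω := fun k hk =>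
    hk.bdd_mul hg.1 hbd
  refine ⟨g, hg, hbd, fun k hk => ?_⟩
  refine hk.induction (P := fun k => Φ (ofDensity ω k) = ∫ x, g x * k x ∂ω) ?_ ?_ ?_ ?_
  · intro c s hs _
    have e : (s.indicator fun _ => c) = c • s.indicator (1 : G → ℂ) := by
      ext x; by_cases hx : x ∈ s <;> simp [hx]
    rw [e, ofDensity_smul, ← restrictTo_ofMeasure hs, map_smul, hset s hs, smul_eq_mul,
      ← integral_const_mul, ← integral_indicator hs]
    refine integral_congr_ae (Eventually.of_forall fun x => ?_)
    by_cases hx : x ∈ s <;> simp [hx, mul_comm]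
  · intro k l _ hk hl h1 h2
    rw [ofDensity_add hk hl, map_add, h1, h2, ← integral_add (hgk k hk) (hgk l hl)]
    simp only [Pi.add_apply, mul_add]
  · refine isClosed_eq ?_ ?_
    · refine LipschitzWith.continuous (K := C) (LipschitzWith.of_dist_le_mul fun k l => ?_)
      have hk := L1.integrable_coeFn k
      have hl := L1.integrable_coeFn l
      rw [dist_eq_norm, dist_eq_norm, L1.norm_eq_integral_norm, ← map_sub, ← ofDensity_sub hk hl]
      refine (hΦ _).trans (le_of_eq ?_)
      rw [totalVar_ofDensity (hk.sub hl)]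
      congr 1
      exact integral_congr_ae ((Lp.coeFn_sub k l).mono fun x hx => by
        change _ = ‖(k - l : Lp ℂ 1 ω) x‖
        rw [hx])
    · refine LipschitzWith.continuous (K := C) (LipschitzWith.of_dist_le_mul fun k l => ?_)
      have hk := L1.integrable_coeFn k
      have hl := L1.integrable_coeFn l
      rw [dist_eq_norm, dist_eq_norm, L1.norm_eq_integral_norm,
        ← integral_sub (hgk _ hk) (hgk _ hl), ← integral_const_mul]
      refine norm_integral_le_of_norm_le ((L1.integrable_coeFn (k - l)).norm.const_mul _) ?_
      filter_upwards [hbd, Lp.coeFn_sub k l] with x h1 h2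
      change _ ≤ (C : ℝ) * ‖(k - l : Lp ℂ 1 ω) x‖
      rw [h2, Pi.sub_apply, ← mul_sub, norm_mul]
      gcongr
  · intro k l hkl _ h
    rw [← ofDensity_congr hkl, h]
    exact integral_congr_ae (hkl.mono fun x hx => by simp only [hx])

/-- The identification of `GL(G)` with `M(G)^*`: every bounded linear form on `M(G)` is the pairing
with a generalised function. -/
theorem exists_pairing_eq (Φ : MeasureAlgebra G →ₗ[ℂ] ℂ) {C : ℝ} (hC : 0 ≤ C)
    (hΦ : ∀ μ, ‖Φ μ‖ ≤ C * totalVar μ) : ∃ f : GenFun G, ∀ μ, pairing f μ = Φ μ := by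
  choose g hg hgb hgΦ using fun μ : MeasureAlgebra G =>
    exists_density_of_bounded Φ hC hΦ (absMeasure μ)
  have hgL : ∀ μ, MemLp (g μ) ∞ (absMeasure μ) := fun μ => memLp_top_of_bound (hg μ).1 C (hgb μ)
  have hcompat : IsCompatible fun μ => (hgL μ).toLp := by
    intro μ ν hμν
    refine (hgL μ).coeFn_toLp.trans (EventuallyEq.trans ?_ (hμν.ae_eq (hgL ν).coeFn_toLp).symm)
    obtain ⟨k, hk, hμ⟩ := exists_ofDensity_eq hμν
    have hac : absMeasure μ = (absMeasure ν).withDensity fun x => ((‖k x‖₊ : ℝ≥0) : ℝ≥0∞) := by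
      conv_lhs => rw [hμ]
      exact absMeasure_ofDensity hk
    have hkm : AEMeasurable (fun x => ‖k x‖₊) (absMeasure ν) := hk.1.nnnorm.aemeasurable
    have hgν : Integrable (g ν) (absMeasure μ) :=
      Integrable.of_bound ((hg ν).1.mono_ac hμν) C (hμν.ae_le (hgb ν))
    -- `1_E |μ|` has the density `‖k‖ 1_E` with respect to `|ν|`; both `g μ` and `g ν` represent
    -- the value of `Φ` at it.
    refine (hg μ).ae_eq_of_forall_setIntegral_eq _ _ hgν fun E hE _ => ?_
    have hE1 : Integrable (E.indicator (1 : G → ℂ)) (absMeasure μ) :=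
      (integrable_const 1).indicator hE
    have hE2 : Integrable (fun x => ‖k x‖₊ • E.indicator (1 : G → ℂ) x) (absMeasure ν) := by
      rw [hac] at hE1
      exact (integrable_withDensity_iff_integrable_smul₀ hkm).1 hE1
    have he : ofDensity (absMeasure μ) (E.indicator 1) =
        ofDensity (absMeasure ν) fun x => ‖k x‖₊ • E.indicator (1 : G → ℂ) x := by
      refine Subtype.ext ?_
      rw [coe_ofDensity, coe_ofDensity, hac]
      exact (withDensityᵥ_smul_eq_withDensityᵥ_withDensity hkm hE2).symm
    have h1 := hgΦ μ _ hE1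
    rw [he, hgΦ ν _ hE2] at h1
    have h2 : ∀ h : G → ℂ, ∫ x in E, h x ∂absMeasure μ =
        ∫ x, h x * E.indicator (1 : G → ℂ) x ∂absMeasure μ := fun h => by
      rw [← integral_indicator hE]
      refine integral_congr_ae (Eventually.of_forall fun x => ?_)
      by_cases hx : x ∈ E <;> simp [hx]
    rw [h2, h2, ← h1]
    conv_rhs => rw [hac]
    rw [integral_withDensity_eq_integral_smul₀ hkm]
    exact integral_congr_ae (Eventually.of_forall fun x => (mul_smul_comm _ _ _))
  let f : GenFun G := ⟨⟨fun μ => (hgL μ).toLp, hcompat.memℓp⟩, hcompat⟩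
  refine ⟨f, fun μ => ?_⟩
  obtain ⟨k, hk, hμ⟩ := exists_ofDensity_eq (Measure.AbsolutelyContinuous.refl (absMeasure μ))
  have h1 := pairing_ofDensity f μ hk
  have h2 := hgΦ μ k hk
  rw [← hμ] at h1 h2
  rw [h1, h2]
  exact integral_congr_ae ((hgL μ).coeFn_toLp.mono fun x hx => by
    have : component f μ x = g μ x := hx
    simp only [this])

/-! ### Convolution as a bounded bilinear map -/

theorem cintegral_const_mul {f : G → ℂ} {μ : ComplexMeasure G} (hf : μ.Integrable f) (c : ℂ) :
    cintegral (fun x => c * f x) μ = c * cintegral f μ := by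
  obtain ⟨k, hk, -, he⟩ := exists_polar μ
  have hf1 : Integrable f (μ.variation.withDensityᵥ k).variation := by rwa [← he]
  have h1 := vintegral_withDensityᵥ hk hf1
  have h2 := vintegral_withDensityᵥ hk (hf1.const_mul c)
  rw [← he] at h1 h2
  rw [cintegral, cintegral, h1, h2, ← integral_const_mul]
  simp only [mul_assoc]

theorem vintegrable_zeroAtInfty (g : C₀(G, ℂ)) (μ : ComplexMeasure G) : μ.Integrable g := by
  obtain ⟨C, hC, hb⟩ := zeroAtInfty_bdd (map_continuous g) (zero_at_infty g)
  exact vintegrable_of_cont_bdd (map_continuous g) hb μ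

theorem vintegrable_translate (g : C₀(G, ℂ)) (y : G) (μ : ComplexMeasure G) :
    μ.Integrable fun x => g (x * y) := by
  obtain ⟨C, hC, hb⟩ := zeroAtInfty_bdd (map_continuous g) (zero_at_infty g)
  have := map_continuous g
  exact vintegrable_of_cont_bdd (by fun_prop) (fun x => hb _) μ

theorem totalVar_le_of_norm_cintegral_le {μ : MeasureAlgebra G} {C : ℝ}
    (h : ∀ g : C₀(G, ℂ), (∀ x, ‖g x‖ ≤ 1) → ‖cintegral g μ‖ ≤ C) : totalVar μ ≤ C :=
  variation_real_le_of_norm_vintegral_le μ.2 isOpen_univ fun g hg _ => h g hg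

/-- An element of `M(G)` is determined by its integrals against `C₀(G)`. -/
theorem MeasureAlgebra.ext_cintegral {μ ν : MeasureAlgebra G}
    (h : ∀ g : C₀(G, ℂ), cintegral g μ = cintegral g ν) : μ = ν := by
  have h1 : totalVar (μ + (-1 : ℂ) • ν) ≤ 0 := totalVar_le_of_norm_cintegral_le fun g _ => by
    have h2 := cintegral_smul_measure (vintegrable_zeroAtInfty g ν) (-1)
    have h3 := cintegral_add_measure (vintegrable_zeroAtInfty g μ)
      (vintegrable_zeroAtInfty g ((-1 : ℂ) • (ν : ComplexMeasure G)))
    rw [h2, h g] at h3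
    change ‖cintegral g ((μ : ComplexMeasure G) + (-1 : ℂ) • (ν : ComplexMeasure G))‖ ≤ 0
    rw [h3]
    simp
  have h2 := totalVar_eq_zero (le_antisymm h1 (totalVar_nonneg _))
  rwa [neg_one_smul ℂ ν, ← sub_eq_add_neg, sub_eq_zero] at h2

theorem totalVar_conv_le (μ ν : MeasureAlgebra G) :
    totalVar (conv μ ν) ≤ totalVar μ * totalVar ν :=
  totalVar_le_of_norm_cintegral_le fun g hg => by
    rw [cintegral_conv]
    have h1 : ∀ y, ‖cintegral (fun x => g (x * y)) μ‖ ≤ totalVar μ := fun y => by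
      simpa [totalVar, cintegral] using
        norm_vintegral_le (C := 1) (fun x => hg (x * y)) (μ : ComplexMeasure G)
    exact norm_vintegral_le h1 _

theorem conv_add_left (μ₁ μ₂ ν : MeasureAlgebra G) :
    conv (μ₁ + μ₂) ν = conv μ₁ ν + conv μ₂ ν := by
  refine MeasureAlgebra.ext_cintegral fun g => ?_
  have h1 : cintegral g ((conv μ₁ ν : ComplexMeasure G) + conv μ₂ ν) = _ :=
    cintegral_add_measure (vintegrable_zeroAtInfty g _) (vintegrable_zeroAtInfty g _)
  refine Eq.trans ?_ h1.symm
  rw [cintegral_conv, cintegral_conv, cintegral_conv]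
  have h2 : (fun y => cintegral (fun x => g (x * y)) ((μ₁ + μ₂ : MeasureAlgebra G) :
      ComplexMeasure G)) = fun y => cintegral (fun x => g (x * y)) μ₁ +
        cintegral (fun x => g (x * y)) μ₂ :=
    funext fun y =>
      cintegral_add_measure (vintegrable_translate g y _) (vintegrable_translate g y _)
  rw [h2]
  exact VectorMeasure.integral_fun_add (vintegrable_vintegral_translate g _ _)
    (vintegrable_vintegral_translate g _ _)

theorem conv_smul_left (c : ℂ) (μ ν : MeasureAlgebra G) : conv (c • μ) ν = c • conv μ ν := by
  refine MeasureAlgebra.ext_cintegral fun g => ?_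
  have h1 : cintegral g (c • (conv μ ν : ComplexMeasure G)) = _ :=
    cintegral_smul_measure (vintegrable_zeroAtInfty g _) c
  refine Eq.trans ?_ h1.symm
  rw [cintegral_conv, cintegral_conv]
  have h2 : (fun y => cintegral (fun x => g (x * y)) ((c • μ : MeasureAlgebra G) :
      ComplexMeasure G)) = fun y => c * cintegral (fun x => g (x * y)) μ :=
    funext fun y => cintegral_smul_measure (vintegrable_translate g y _) c
  rw [h2]
  exact cintegral_const_mul (vintegrable_vintegral_translate g _ _) c

theorem conv_add_right (μ ν₁ ν₂ : MeasureAlgebra G) :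
    conv μ (ν₁ + ν₂) = conv μ ν₁ + conv μ ν₂ := by
  refine MeasureAlgebra.ext_cintegral fun g => ?_
  have h1 : cintegral g ((conv μ ν₁ : ComplexMeasure G) + conv μ ν₂) = _ :=
    cintegral_add_measure (vintegrable_zeroAtInfty g _) (vintegrable_zeroAtInfty g _)
  refine Eq.trans ?_ h1.symm
  rw [cintegral_conv, cintegral_conv, cintegral_conv]
  exact cintegral_add_measure (vintegrable_vintegral_translate g _ _)
    (vintegrable_vintegral_translate g _ _)

theorem conv_smul_right (c : ℂ) (μ ν : MeasureAlgebra G) : conv μ (c • ν) = c • conv μ ν := by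
  refine MeasureAlgebra.ext_cintegral fun g => ?_
  have h1 : cintegral g (c • (conv μ ν : ComplexMeasure G)) = _ :=
    cintegral_smul_measure (vintegrable_zeroAtInfty g _) c
  refine Eq.trans ?_ h1.symm
  rw [cintegral_conv, cintegral_conv]
  exact cintegral_smul_measure (vintegrable_vintegral_translate g _ _) c

/-- The convolution of measures carried by compact sets `A` and `B` is carried by `A * B`. -/
theorem absMeasure_conv_compl_eq_zero {μ ν : MeasureAlgebra G} {A B : Set G} (hA : IsCompact A)
    (hB : IsCompact B) (hμ : absMeasure μ Aᶜ = 0) (hν : absMeasure ν Bᶜ = 0) :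
    absMeasure (conv μ ν) (A * B)ᶜ = 0 := by
  have h1 : (absMeasure (conv μ ν)).real (A * B)ᶜ ≤ 0 := by
    refine variation_real_le_of_norm_vintegral_le (conv μ ν).2
      (hA.mul hB).isClosed.isOpen_compl fun g _ hg => ?_
    have hA' : ∀ᵐ x ∂absMeasure μ, x ∈ A := by rwa [← mem_ae_iff] at hμ
    have hB' : ∀ᵐ x ∂absMeasure ν, x ∈ B := by rwa [← mem_ae_iff] at hν
    refine (congrArg norm (cintegral_conv μ ν g)).trans_le ?_
    have h2 : cintegral (fun y => cintegral (fun x => g (x * y)) μ) ν = 0 := by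
      refine VectorMeasure.integral_eq_zero_of_ae (hB'.mono fun y hy => ?_)
      refine VectorMeasure.integral_eq_zero_of_ae (hA'.mono fun x hx => ?_)
      exact hg _ fun h => h (mul_mem_mul hx hy)
    rw [h2, norm_zero]
  exact (measureReal_eq_zero_iff).1 (le_antisymm h1 measureReal_nonneg)

/-! ### Compactly carried generalised functions -/

noncomputable instance instNormedAddCommGroupGenFun : NormedAddCommGroup (GenFun G) :=
  Submodule.normedAddCommGroup _

noncomputable instance instNormedSpaceGenFun : NormedSpace ℂ (GenFun G) :=
  Submodule.normedSpace _

noncomputable instance instNormedAddCommGroupGenFunZero : NormedAddCommGroup (GenFunZero G) :=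
  Submodule.normedAddCommGroup _

noncomputable instance instNormedSpaceGenFunZero : NormedSpace ℂ (GenFunZero G) :=
  Submodule.normedSpace _

/-- The scalar that rotates `z` onto the positive axis and divides it by `t`. -/
theorem exists_norm_eq_mul_eq {z : ℂ} (hz : z ≠ 0) {t : ℝ} (ht : 0 < t) :
    ∃ c : ℂ, ‖c‖ = t⁻¹ ∧ c * z = (‖z‖ / t : ℝ) := by
  have hz0 : 0 < ‖z‖ := norm_pos_iff.2 hz
  have h1 : (starRingEnd ℂ) z * z = ((‖z‖ ^ 2 : ℝ) : ℂ) := by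
    rw [mul_comm, Complex.mul_conj, Complex.normSq_eq_norm_sq]
  refine ⟨(starRingEnd ℂ) z / (‖z‖ * t : ℝ), ?_, ?_⟩
  · rw [norm_div, RCLike.norm_conj, Complex.norm_real, Real.norm_of_nonneg (mul_pos hz0 ht).le]
    field_simp
  · rw [div_mul_eq_mul_div, h1, ← Complex.ofReal_div]
    congr 1
    field_simp

theorem exists_isCompact_totalVar_restrictTo_lt (ζ : MeasureAlgebra G) {A : Set G}
    (hA : MeasurableSet A) (hζ : absMeasure ζ Aᶜ = 0) {η : ℝ} (hη : 0 < η) :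
    ∃ L ⊆ A, IsCompact L ∧ totalVar (restrictTo Lᶜ ζ) < η := by
  obtain ⟨L, hLA, hL, -, h⟩ := hA.exists_isCompact_isClosed_sdiff_lt (μ := absMeasure ζ)
    (measure_ne_top _ _) (ENNReal.ofReal_pos.2 hη).ne'
  refine ⟨L, hLA, hL, ?_⟩
  have h1 : absMeasure ζ Lᶜ ≤ absMeasure ζ (A \ L) := by
    have h2 : Lᶜ ⊆ (A \ L) ∪ Aᶜ := fun x hx => by
      by_cases h : x ∈ A
      · exact Or.inl ⟨h, hx⟩
      · exact Or.inr h
    refine (measure_mono h2).trans ((measure_union_le _ _).trans ?_)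
    rw [hζ, add_zero]
  rw [totalVar_restrictTo hL.measurableSet.compl, measureReal_def]
  exact ENNReal.toReal_lt_of_lt_ofReal (h1.trans_lt h)

theorem absMeasure_real_add_le (μ ν : MeasureAlgebra G) (A : Set G) :
    (absMeasure (μ + ν)).real A ≤ (absMeasure μ).real A + (absMeasure ν).real A := by
  have h : absMeasure (μ + ν) ≤ absMeasure μ + absMeasure ν := VectorMeasure.variation_add_le
  rw [measureReal_def, measureReal_def, measureReal_def,
    ← ENNReal.toReal_add (measure_ne_top _ _) (measure_ne_top _ _)]
  exact ENNReal.toReal_mono (by finiteness) (h A)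

/-- `f` is carried by `K`: it annihilates the measures that do not charge `K`. -/
def SupportedIn (f : GenFun G) (K : Set G) : Prop :=
  ∀ μ : MeasureAlgebra G, absMeasure μ K = 0 → pairing f μ = 0

theorem SupportedIn.mono {f : GenFun G} {K L : Set G} (h : SupportedIn f K) (hKL : K ⊆ L) :
    SupportedIn f L := fun μ hμ => h μ (measure_mono_null hKL hμ)

theorem SupportedIn.add {f g : GenFun G} {K : Set G} (hf : SupportedIn f K)
    (hg : SupportedIn g K) : SupportedIn (f + g) K := fun μ hμ => by
  rw [pairing_add_left, hf μ hμ, hg μ hμ, add_zero]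

theorem SupportedIn.smul {f : GenFun G} {K : Set G} (c : ℂ) (hf : SupportedIn f K) :
    SupportedIn (c • f) K := fun μ hμ => by
  rw [pairing_smul_left, hf μ hμ, mul_zero]

theorem SupportedIn.mem_genFunZero {f : GenFun G} {K : Set G} (hf : SupportedIn f K)
    (hK : IsCompact K) : f ∈ GenFunZero G :=
  (vanishesAtInfinity_iff f).2 fun ε hε => ⟨K, hK, fun μ hμ => by
    rw [hf μ hμ, norm_zero]
    exact mul_nonneg hε.le (totalVar_nonneg μ)⟩

theorem supportedIn_zero (K : Set G) : SupportedIn (0 : GenFun G) K := fun μ _ => by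
  simpa using pairing_smul_left 0 (0 : GenFun G) μ

/-- Generalised functions carried by disjoint sets add with the maximum of their norms. -/
theorem SupportedIn.norm_add_le {f g : GenFun G} {S T : Set G} (hf : SupportedIn f S)
    (hg : SupportedIn g T) (hS : MeasurableSet S) (h : Disjoint S T) {C : ℝ} (hC : 0 ≤ C)
    (hfC : ‖f‖ ≤ C) (hgC : ‖g‖ ≤ C) : ‖f + g‖ ≤ C := by
  refine norm_le_of_norm_pairing_le _ hC fun μ => ?_
  have h1 : pairing f (restrictTo Sᶜ μ) = 0 :=
    hf _ (absMeasure_restrictTo_null hS.compl μ disjoint_compl_left)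
  have h2 : pairing g (restrictTo S μ) = 0 := hg _ (absMeasure_restrictTo_null hS μ h)
  have e : pairing (f + g) μ = pairing f (restrictTo S μ) + pairing g (restrictTo Sᶜ μ) := by
    conv_lhs => rw [← restrictTo_add_compl hS μ]
    rw [pairing_add_left, pairing_add_right, pairing_add_right, h1, h2, add_zero, zero_add]
  rw [e, ← totalVar_restrictTo_add_compl hS μ, mul_add]
  refine (_root_.norm_add_le _ _).trans (add_le_add ?_ ?_)
  · exact (norm_pairing_le _ _).trans (mul_le_mul_of_nonneg_right hfC (totalVar_nonneg _))
  · exact (norm_pairing_le _ _).trans (mul_le_mul_of_nonneg_right hgC (totalVar_nonneg _))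

/-- Generalised functions vanishing at infinity are norm limits of compactly carried ones. -/
theorem exists_supportedIn_norm_sub_le {f : GenFun G} (hf : f ∈ GenFunZero G) {δ : ℝ}
    (hδ : 0 < δ) : ∃ (K : Set G) (g : GenFun G), IsCompact K ∧ SupportedIn g K ∧ ‖f - g‖ ≤ δ := by
  obtain ⟨K, hK, h⟩ := (vanishesAtInfinity_iff f).1 hf δ hδ
  obtain ⟨g, hg⟩ := exists_pairing_eq ((pairingₗ f).comp (restrictTo K)) (norm_nonneg f)
    fun μ => (norm_pairing_le f _).trans
      (mul_le_mul_of_nonneg_left (totalVar_restrictTo_le hK.measurableSet μ) (norm_nonneg f))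
  refine ⟨K, g, hK, fun μ hμ => ?_, norm_le_of_norm_pairing_le _ hδ.le fun μ => ?_⟩
  · have h0 : totalVar (restrictTo K μ) = 0 := by
      rw [totalVar_restrictTo hK.measurableSet, measureReal_def, hμ, ENNReal.toReal_zero]
    rw [hg, LinearMap.comp_apply, totalVar_eq_zero h0, map_zero]
  · have e : pairing (f - g) μ = pairing f (restrictTo Kᶜ μ) := by
      have h1 : f - g = f + (-1 : ℂ) • g := by rw [neg_one_smul, sub_eq_add_neg]
      rw [h1, pairing_add_left, pairing_smul_left, hg]
      conv_lhs => rw [← restrictTo_add_compl hK.measurableSet μ]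
      rw [pairing_add_right]
      simp only [restrictTo_add_compl hK.measurableSet, LinearMap.comp_apply, pairingₗ_apply]
      ring
    rw [e]
    refine (h _ (absMeasure_restrictTo_null hK.measurableSet.compl μ disjoint_compl_left)).trans ?_
    exact mul_le_mul_of_nonneg_left (totalVar_restrictTo_le hK.measurableSet.compl μ) hδ.le

/-! ### Products on `M(G)` that respect compact carriers, and their actions -/

variable (G) in
/-- A bounded bilinear product on `M(G)` that respects compact carriers. `quot L K` is the set of
the points that the points of `L` multiply into `K`. The convolution and its opposite are such
products, so that the left and the right half of the introversion have one proof. -/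
structure CarriedProduct where
  /-- The product `ζ · μ`. -/
  prod : MeasureAlgebra G →ₗ[ℂ] MeasureAlgebra G →ₗ[ℂ] MeasureAlgebra G
  totalVar_prod_le : ∀ ζ μ, totalVar (prod ζ μ) ≤ totalVar ζ * totalVar μ
  /-- For convolution, `L⁻¹ K`: the points `c` with `l c ∈ K` for some `l ∈ L`. -/
  quot : Set G → Set G → Set G
  isCompact_quot : ∀ {L K}, IsCompact L → IsCompact K → IsCompact (quot L K)
  /-- If no point of `L` multiplies a point of `C` into `K`, the product of measures carried by `L`
  and `C` does not charge `K`. -/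
  prod_null : ∀ {L C K : Set G} {ζ μ : MeasureAlgebra G}, IsCompact L → IsCompact C →
    IsCompact K → absMeasure ζ Lᶜ = 0 → absMeasure μ Cᶜ = 0 → Disjoint C (quot L K) →
    absMeasure (prod ζ μ) K = 0
  /-- Moving `L` off a suitable compact set moves `quot L K` off a given compact set `S`. -/
  exists_sep : ∀ {K S : Set G}, IsCompact K → IsCompact S →
    ∃ T, IsCompact T ∧ ∀ L, Disjoint L T → Disjoint S (quot L K)

namespace CarriedProduct

variable (P : CarriedProduct G)

/-- The hypothesis on `μ` in `prod_null` weakens to `μ` not charging `quot L K`: such a `μ` is a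
norm limit of measures carried by compact sets disjoint from `quot L K`. -/
theorem absMeasure_prod_eq_zero {L K : Set G} {ζ μ : MeasureAlgebra G} (hL : IsCompact L)
    (hK : IsCompact K) (hζ : absMeasure ζ Lᶜ = 0) (hμ : absMeasure μ (P.quot L K) = 0) :
    absMeasure (P.prod ζ μ) K = 0 := by
  have hq := (P.isCompact_quot hL hK).measurableSet
  have h1 : (absMeasure (P.prod ζ μ)).real K ≤ 0 := by
    refine le_of_forall_pos_le_add fun ε hε => ?_
    have hpos : 0 < totalVar ζ + 1 := by linarith [totalVar_nonneg ζ]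
    obtain ⟨C, hCq, hC, hCε⟩ := exists_isCompact_totalVar_restrictTo_lt μ hq.compl
      (by rwa [compl_compl]) (div_pos hε hpos)
    have h2 : absMeasure (P.prod ζ (restrictTo C μ)) K = 0 :=
      P.prod_null hL hC hK hζ (absMeasure_restrictTo_compl hC.measurableSet μ)
        (subset_compl_iff_disjoint_right.1 hCq)
    have h3 := absMeasure_real_add_le (P.prod ζ (restrictTo C μ)) (P.prod ζ (restrictTo Cᶜ μ)) K
    rw [← map_add, restrictTo_add_compl hC.measurableSet, measureReal_def (absMeasure
      (P.prod ζ (restrictTo C μ))), h2, ENNReal.toReal_zero] at h3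
    have h4 : (absMeasure (P.prod ζ (restrictTo Cᶜ μ))).real K ≤
        totalVar ζ * totalVar (restrictTo Cᶜ μ) :=
      (measureReal_mono (subset_univ _)).trans (P.totalVar_prod_le _ _)
    have h5 := (lt_div_iff₀ hpos).1 hCε
    nlinarith [totalVar_nonneg (restrictTo Cᶜ μ)]
  exact (measureReal_eq_zero_iff).1 (le_antisymm h1 measureReal_nonneg)

theorem norm_pairing_prod_le (f : GenFun G) (ζ μ : MeasureAlgebra G) :
    ‖pairing f (P.prod ζ μ)‖ ≤ ‖f‖ * totalVar ζ * totalVar μ := by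
  rw [mul_assoc]
  exact (norm_pairing_le f _).trans
    (mul_le_mul_of_nonneg_left (P.totalVar_prod_le ζ μ) (norm_nonneg f))

theorem exists_act (f : GenFun G) (ζ : MeasureAlgebra G) :
    ∃ g : GenFun G, ∀ μ, pairing g μ = pairing f (P.prod ζ μ) :=
  exists_pairing_eq ((pairingₗ f).comp (P.prod ζ))
    (mul_nonneg (norm_nonneg f) (totalVar_nonneg ζ)) (P.norm_pairing_prod_le f ζ)

/-- The generalised function `μ ↦ ⟨f, ζ · μ⟩`. -/
noncomputable def act (f : GenFun G) (ζ : MeasureAlgebra G) : GenFun G := (P.exists_act f ζ).choose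

theorem pairing_act (f : GenFun G) (ζ μ : MeasureAlgebra G) :
    pairing (P.act f ζ) μ = pairing f (P.prod ζ μ) := (P.exists_act f ζ).choose_spec μ

theorem norm_act_le (f : GenFun G) (ζ : MeasureAlgebra G) : ‖P.act f ζ‖ ≤ ‖f‖ * totalVar ζ :=
  norm_le_of_norm_pairing_le _ (mul_nonneg (norm_nonneg f) (totalVar_nonneg ζ)) fun μ => by
    rw [pairing_act]
    exact P.norm_pairing_prod_le f ζ μ

theorem supportedIn_act {f : GenFun G} {K L : Set G} (hf : SupportedIn f K) (hK : IsCompact K)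
    (hL : IsCompact L) {ζ : MeasureAlgebra G} (hζ : absMeasure ζ Lᶜ = 0) :
    SupportedIn (P.act f ζ) (P.quot L K) := fun μ hμ => by
  rw [pairing_act]
  exact hf _ (P.absMeasure_prod_eq_zero hL hK hζ hμ)

/-- Up to a small error, `ζ` is carried by a compact set `L`, and `ζ · μ` then does not charge `K`
as soon as `μ` does not charge `quot L K`. -/
theorem act_mem_genFunZero {f : GenFun G} (hf : f ∈ GenFunZero G) (ζ : MeasureAlgebra G) :
    P.act f ζ ∈ GenFunZero G := by
  refine (vanishesAtInfinity_iff _).2 fun ε hε => ?_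
  have hpos : 0 < ‖f‖ + totalVar ζ + 1 := by linarith [totalVar_nonneg ζ, norm_nonneg f]
  set δ := ε / (‖f‖ + totalVar ζ + 1) with hδ
  have hδpos : 0 < δ := div_pos hε hpos
  have hδε : δ * (‖f‖ + totalVar ζ + 1) = ε := div_mul_cancel₀ _ hpos.ne'
  obtain ⟨K, hK, hfK⟩ := (vanishesAtInfinity_iff f).1 hf δ hδpos
  obtain ⟨L, -, hL, hLδ⟩ := exists_isCompact_totalVar_restrictTo_lt ζ MeasurableSet.univ
    (by simp) hδpos
  refine ⟨P.quot L K, P.isCompact_quot hL hK, fun μ hμ => ?_⟩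
  have h1 : ‖pairing f (P.prod (restrictTo L ζ) μ)‖ ≤ δ * (totalVar ζ * totalVar μ) := by
    refine (hfK _ (P.absMeasure_prod_eq_zero hL hK
      (absMeasure_restrictTo_compl hL.measurableSet ζ) hμ)).trans ?_
    refine mul_le_mul_of_nonneg_left ((P.totalVar_prod_le _ _).trans ?_) hδpos.le
    exact mul_le_mul_of_nonneg_right (totalVar_restrictTo_le hL.measurableSet ζ)
      (totalVar_nonneg μ)
  have h2 : ‖pairing f (P.prod (restrictTo Lᶜ ζ) μ)‖ ≤ ‖f‖ * δ * totalVar μ := by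
    refine (P.norm_pairing_prod_le _ _ _).trans ?_
    gcongr
    exact totalVar_nonneg μ
  have e : pairing (P.act f ζ) μ =
      pairing f (P.prod (restrictTo L ζ) μ) + pairing f (P.prod (restrictTo Lᶜ ζ) μ) := by
    rw [pairing_act, ← pairing_add_right, ← LinearMap.add_apply, ← map_add,
      restrictTo_add_compl hL.measurableSet]
  rw [e, ← hδε]
  refine (norm_add_le _ _).trans ((add_le_add h1 h2).trans ?_)
  nlinarith [mul_nonneg hδpos.le (totalVar_nonneg μ)]

/-- The action on `GL₀(G)`, as a bilinear map. -/
noncomputable def zeroAct : GenFunZero G →ₗ[ℂ] MeasureAlgebra G →ₗ[ℂ] GenFunZero G :=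
  LinearMap.mk₂ ℂ (fun f ζ => ⟨P.act f ζ, P.act_mem_genFunZero f.2 ζ⟩)
    (fun f g ζ => Subtype.ext <| GenFun.ext_pairing fun μ => by
      change pairing (P.act (f + g : GenFun G) ζ) μ = pairing (P.act f ζ + P.act g ζ) μ
      rw [pairing_add_left, pairing_act, pairing_act, pairing_act, pairing_add_left])
    (fun c f ζ => Subtype.ext <| GenFun.ext_pairing fun μ => by
      change pairing (P.act (c • f : GenFun G) ζ) μ = pairing (c • P.act f ζ) μ
      rw [pairing_smul_left, pairing_act, pairing_act, pairing_smul_left])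
    (fun f ζ ξ => Subtype.ext <| GenFun.ext_pairing fun μ => by
      change pairing (P.act f (ζ + ξ)) μ = pairing (P.act f ζ + P.act f ξ) μ
      rw [pairing_add_left, pairing_act, pairing_act, pairing_act, map_add, LinearMap.add_apply,
        pairing_add_right])
    (fun c f ζ => Subtype.ext <| GenFun.ext_pairing fun μ => by
      change pairing (P.act f (c • ζ)) μ = pairing (c • P.act f ζ) μ
      rw [pairing_smul_left, pairing_act, pairing_act, map_smul, LinearMap.smul_apply,
        pairing_smul_right])

theorem pairing_zeroAct (f : GenFunZero G) (ζ μ : MeasureAlgebra G) :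
    pairing (P.zeroAct f ζ : GenFun G) μ = pairing (f : GenFun G) (P.prod ζ μ) :=
  P.pairing_act f ζ μ

theorem eq_zeroAct {f g : GenFunZero G} {ζ : MeasureAlgebra G}
    (h : ∀ μ, pairing (g : GenFun G) μ = pairing (f : GenFun G) (P.prod ζ μ)) :
    g = P.zeroAct f ζ :=
  Subtype.ext <| GenFun.ext_pairing fun μ => by rw [h, pairing_zeroAct]

theorem norm_apply_zeroAct_le (m : StrongDual ℂ (GenFunZero G)) (f : GenFunZero G)
    (ζ : MeasureAlgebra G) : ‖m (P.zeroAct f ζ)‖ ≤ ‖m‖ * ‖f‖ * totalVar ζ := by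
  rw [mul_assoc]
  exact (m.le_opNorm _).trans (mul_le_mul_of_nonneg_left (P.norm_act_le f ζ) (norm_nonneg m))

/-! ### The dual action preserves vanishing at infinity -/

/-- If `ζ ↦ ⟨m, f ζ⟩` exceeds `ε` at a measure that does not charge the compact set `T`, then it
does so at a measure carried by a compact set disjoint from `T`. -/
theorem exists_isCompact_lt_norm_apply {m : StrongDual ℂ (GenFunZero G)} {f : GenFunZero G}
    {ε : ℝ} (hε : 0 ≤ ε) {T : Set G} (hT : IsCompact T) {ζ : MeasureAlgebra G}
    (hζ : absMeasure ζ T = 0) (h : ε * totalVar ζ < ‖m (P.zeroAct f ζ)‖) :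
    ∃ (L : Set G) (ξ : MeasureAlgebra G), IsCompact L ∧ Disjoint L T ∧ absMeasure ξ Lᶜ = 0 ∧
      ε * totalVar ξ < ‖m (P.zeroAct f ξ)‖ := by
  have hM : 0 < ‖m‖ * ‖f‖ + 1 := by positivity
  obtain ⟨L, hLT, hL, hLη⟩ := exists_isCompact_totalVar_restrictTo_lt ζ hT.measurableSet.compl
    (by rwa [compl_compl]) (div_pos (sub_pos.2 h) hM)
  refine ⟨L, restrictTo L ζ, hL, subset_compl_iff_disjoint_right.1 hLT,
    absMeasure_restrictTo_compl hL.measurableSet ζ, ?_⟩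
  have h1 := (lt_div_iff₀ hM).1 hLη
  have h2 := P.norm_apply_zeroAct_le m f (restrictTo Lᶜ ζ)
  have h3 : ‖m (P.zeroAct f ζ)‖ ≤ ‖m (P.zeroAct f (restrictTo L ζ))‖ +
      ‖m (P.zeroAct f (restrictTo Lᶜ ζ))‖ := by
    conv_lhs => rw [← restrictTo_add_compl hL.measurableSet ζ]
    rw [map_add, map_add]
    exact norm_add_le _ _
  have h4 := mul_le_mul_of_nonneg_left (totalVar_restrictTo_le hL.measurableSet ζ) hε
  linarith [totalVar_nonneg (restrictTo Lᶜ ζ)]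

/-- For compactly carried `f`, the form `ζ ↦ ⟨m, f ζ⟩` vanishes at infinity. Otherwise there would
be arbitrarily many measures `ζ` at which it exceeds `ε` and for which the `f ζ` are carried by
disjoint compact sets; the norm of a unimodular combination of the `f ζ` stays below `‖f‖`, while
the value of `m` at it grows without bound. -/
theorem exists_isCompact_norm_apply_le_of_supportedIn (m : StrongDual ℂ (GenFunZero G))
    {f : GenFunZero G} {K : Set G} (hK : IsCompact K) (hf : SupportedIn (f : GenFun G) K) {ε : ℝ}
    (hε : 0 < ε) : ∃ T, IsCompact T ∧ ∀ ζ : MeasureAlgebra G, absMeasure ζ T = 0 →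
      ‖m (P.zeroAct f ζ)‖ ≤ ε * totalVar ζ := by
  by_contra! hcon
  have key : ∀ n : ℕ, ∃ (F : GenFunZero G) (S : Set G), IsCompact S ∧
      SupportedIn (F : GenFun G) S ∧ ‖F‖ ≤ ‖f‖ ∧ n * ε ≤ (m F).re := by
    intro n
    induction n with
    | zero =>
      exact ⟨0, ∅, isCompact_empty, supportedIn_zero ∅, by simp, by simp⟩
    | succ n ih =>
      obtain ⟨F, S, hS, hFS, hFf, hFn⟩ := ih
      obtain ⟨T, hT, hsep⟩ := P.exists_sep hK hS
      obtain ⟨ζ, hζT, hζ⟩ := hcon T hT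
      obtain ⟨L, ξ, hL, hLT, hξL, hξ⟩ := P.exists_isCompact_lt_norm_apply hε.le hT hζT hζ
      have htv : 0 < totalVar ξ := by
        refine (totalVar_nonneg ξ).lt_of_ne' fun h0 => ?_
        rw [h0, totalVar_eq_zero h0, map_zero, map_zero] at hξ
        simp at hξ
      have hz0 : m (P.zeroAct f ξ) ≠ 0 :=
        norm_pos_iff.1 ((mul_nonneg hε.le htv.le).trans_lt hξ)
      obtain ⟨c, hcn, hcz⟩ := exists_norm_eq_mul_eq hz0 htv
      have hsupp := P.supportedIn_act hf hK hL hξL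
      refine ⟨F + c • P.zeroAct f ξ, S ∪ P.quot L K, hS.union (P.isCompact_quot hL hK), ?_, ?_, ?_⟩
      · exact (hFS.mono subset_union_left).add ((hsupp.smul c).mono subset_union_right)
      · refine hFS.norm_add_le (hsupp.smul c) hS.measurableSet (hsep L hLT) (norm_nonneg f) hFf ?_
        rw [norm_smul, hcn, inv_mul_le_iff₀ htv, mul_comm]
        exact P.norm_act_le f ξ
      · have h1 : ε ≤ ‖m (P.zeroAct f ξ)‖ / totalVar ξ := (le_div_iff₀ htv).2 hξ.le
        rw [map_add, map_smul, smul_eq_mul, hcz, Complex.add_re, Complex.ofReal_re]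
        push_cast
        linarith
  obtain ⟨n, hn⟩ := exists_nat_gt (‖m‖ * ‖f‖ / ε)
  obtain ⟨F, S, -, -, hFf, hFn⟩ := key n
  have h1 := (div_lt_iff₀ hε).1 hn
  have h2 := (Complex.re_le_norm (m F)).trans ((m.le_opNorm F).trans
    (mul_le_mul_of_nonneg_left hFf (norm_nonneg m)))
  linarith

/-- The generalised function `ζ ↦ ⟨m, f ζ⟩` vanishes at infinity; the case of compactly carried `f`
suffices, since these `f` are dense in `GL₀(G)`. -/
theorem exists_dualAct (m : StrongDual ℂ (GenFunZero G)) (f : GenFunZero G) :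
    ∃ h : GenFunZero G, ∀ ζ, pairing (h : GenFun G) ζ = m (P.zeroAct f ζ) := by
  obtain ⟨h, hh⟩ := exists_pairing_eq (m.toLinearMap.comp (P.zeroAct f))
    (C := ‖m‖ * ‖f‖) (by positivity) (P.norm_apply_zeroAct_le m f)
  refine ⟨⟨h, (vanishesAtInfinity_iff h).2 fun ε hε => ?_⟩, hh⟩
  have hpos : 0 < ‖m‖ + 1 := by positivity
  obtain ⟨K, g, hK, hg, hfg⟩ := exists_supportedIn_norm_sub_le f.2
    (div_pos (half_pos hε) hpos)
  let g₀ : GenFunZero G := ⟨g, hg.mem_genFunZero hK⟩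
  obtain ⟨T, hT, hmT⟩ := P.exists_isCompact_norm_apply_le_of_supportedIn m (f := g₀) hK hg
    (half_pos hε)
  refine ⟨T, hT, fun ζ hζ => ?_⟩
  have h1 := hmT ζ hζ
  have h2 := P.norm_apply_zeroAct_le m (f - g₀) ζ
  have h3 : ‖f - g₀‖ ≤ ε / 2 / (‖m‖ + 1) := hfg
  have h4 : ‖m‖ * ‖f - g₀‖ ≤ ε / 2 := by
    have := (le_div_iff₀ hpos).1 h3
    nlinarith [norm_nonneg (f - g₀)]
  have e : pairing h ζ = m (P.zeroAct (f - g₀) ζ) + m (P.zeroAct g₀ ζ) := by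
    have e1 : P.zeroAct f ζ = P.zeroAct (f - g₀) ζ + P.zeroAct g₀ ζ := by
      rw [← LinearMap.add_apply, ← map_add, sub_add_cancel]
    rw [← m.map_add, ← e1]
    exact hh ζ
  rw [e]
  refine (norm_add_le _ _).trans ?_
  nlinarith [mul_le_mul_of_nonneg_right h4 (totalVar_nonneg ζ)]

end CarriedProduct

/-! ### Convolution, opposite convolution and introversion -/

variable (G) in
/-- Convolution as a bilinear map on `M(G)`. -/
noncomputable def convₗ : MeasureAlgebra G →ₗ[ℂ] MeasureAlgebra G →ₗ[ℂ] MeasureAlgebra G :=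
  LinearMap.mk₂ ℂ conv conv_add_left conv_smul_left conv_add_right conv_smul_right

variable (G) in
/-- The convolution `(ζ, μ) ↦ ζ ∗ μ`. -/
noncomputable def convProduct : CarriedProduct G where
  prod := convₗ G
  totalVar_prod_le := totalVar_conv_le
  quot L K := L⁻¹ * K
  isCompact_quot hL hK := hL.inv.mul hK
  prod_null {L C K ζ μ} hL hC _ hζ hμ h := by
    refine measure_mono_null (t := (L * C)ᶜ) ?_ (absMeasure_conv_compl_eq_zero hL hC hζ hμ)
    intro z hzK hz
    obtain ⟨l, hl, c, hc, rfl⟩ := hz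
    exact h.le_bot ⟨hc, l⁻¹, inv_mem_inv.2 hl, l * c, hzK, by group⟩
  exists_sep {K S} hK hS := ⟨K * S⁻¹, hK.mul hS.inv, fun L hL => by
    refine disjoint_left.2 fun s hs hq => ?_
    obtain ⟨l, hl, k, hk, rfl⟩ := hq
    refine hL.le_bot ⟨mem_inv.1 hl, k, hk, (l * k)⁻¹, inv_mem_inv.2 hs, by group⟩⟩

variable (G) in
/-- The opposite convolution `(ζ, μ) ↦ μ ∗ ζ`. -/
noncomputable def convOpProduct : CarriedProduct G where
  prod := (convₗ G).flip
  totalVar_prod_le ζ μ := (totalVar_conv_le μ ζ).trans_eq (mul_comm _ _)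
  quot L K := K * L⁻¹
  isCompact_quot hL hK := hK.mul hL.inv
  prod_null {L C K ζ μ} hL hC _ hζ hμ h := by
    refine measure_mono_null (t := (C * L)ᶜ) ?_ (absMeasure_conv_compl_eq_zero hC hL hμ hζ)
    intro z hzK hz
    obtain ⟨c, hc, l, hl, rfl⟩ := hz
    exact h.le_bot ⟨hc, c * l, hzK, l⁻¹, inv_mem_inv.2 hl, by group⟩
  exists_sep {K S} hK hS := ⟨S⁻¹ * K, hS.inv.mul hK, fun L hL => by
    refine disjoint_left.2 fun s hs hq => ?_
    obtain ⟨k, hk, l, hl, rfl⟩ := hq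
    refine hL.le_bot ⟨mem_inv.1 hl, (k * l)⁻¹, inv_mem_inv.2 hs, k, hk, by group⟩⟩

theorem isRightAct_iff {f g : GenFunZero G} {ζ : MeasureAlgebra G} :
    IsRightAct (f : GenFun G) ζ g ↔ g = (convProduct G).zeroAct f ζ :=
  ⟨fun h => (convProduct G).eq_zeroAct h, fun h μ => by
    rw [h]; exact (convProduct G).pairing_zeroAct f ζ μ⟩

theorem isLeftAct_iff {f g : GenFunZero G} {ζ : MeasureAlgebra G} :
    IsLeftAct ζ (f : GenFun G) g ↔ g = (convOpProduct G).zeroAct f ζ :=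
  ⟨fun h => (convOpProduct G).eq_zeroAct h, fun h μ => by
    rw [h]; exact (convOpProduct G).pairing_zeroAct f ζ μ⟩

theorem isLeftDualAct_iff {m : StrongDual ℂ (GenFunZero G)} {f : GenFunZero G} {h : GenFun G} :
    IsLeftDualAct (GenFunZero G) m f h ↔
      ∀ ζ, pairing h ζ = m ((convProduct G).zeroAct f ζ) :=
  ⟨fun H ζ => H ζ _ (isRightAct_iff.2 rfl), fun H ζ g hg => by rw [H, isRightAct_iff.1 hg]⟩

theorem isRightDualAct_iff {m : StrongDual ℂ (GenFunZero G)} {f : GenFunZero G} {h : GenFun G} :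
    IsRightDualAct (GenFunZero G) f m h ↔
      ∀ ζ, pairing h ζ = m ((convOpProduct G).zeroAct f ζ) :=
  ⟨fun H ζ => H ζ _ (isLeftAct_iff.2 rfl), fun H ζ g hg => by rw [H, isLeftAct_iff.1 hg]⟩

theorem isLeftIntroverted_genFunZero : IsLeftIntroverted (GenFunZero G) := by
  refine ⟨fun f ζ => ⟨_, isRightAct_iff.2 rfl, fun g hg => isRightAct_iff.1 hg⟩, fun m f => ?_⟩
  obtain ⟨h, hh⟩ := (convProduct G).exists_dualAct m f
  refine ⟨h, isLeftDualAct_iff.2 hh, fun g hg => Subtype.ext (GenFun.ext_pairing fun ζ => ?_)⟩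
  rw [hh, isLeftDualAct_iff.1 hg]

theorem isRightIntroverted_genFunZero : IsRightIntroverted (GenFunZero G) := by
  refine ⟨fun f ζ => ⟨_, isLeftAct_iff.2 rfl, fun g hg => isLeftAct_iff.1 hg⟩, fun m f => ?_⟩
  obtain ⟨h, hh⟩ := (convOpProduct G).exists_dualAct m f
  refine ⟨h, isRightDualAct_iff.2 hh, fun g hg => Subtype.ext (GenFun.ext_pairing fun ζ => ?_)⟩
  rw [hh, isRightDualAct_iff.1 hg]

/-- For fixed `n`, the map `f ↦ n f` is a bounded operator on `GL₀(G)`. -/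
theorem exists_leftDualAct_clm (n : StrongDual ℂ (GenFunZero G)) :
    ∃ T : GenFunZero G →L[ℂ] GenFunZero G, ∀ f, IsLeftDualAct (GenFunZero G) n f (T f) := by
  choose h hh using (convProduct G).exists_dualAct n
  have hadd : ∀ f g : GenFunZero G, h (f + g) = h f + h g := fun f g =>
    Subtype.ext <| GenFun.ext_pairing fun ζ => by
      have h1 : (convProduct G).zeroAct (f + g) ζ =
          (convProduct G).zeroAct f ζ + (convProduct G).zeroAct g ζ := by
        rw [map_add, LinearMap.add_apply]
      have h2 := (congrArg n h1).trans
        (n.map_add ((convProduct G).zeroAct f ζ) ((convProduct G).zeroAct g ζ))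
      have h3 := pairing_add_left (h f : GenFun G) (h g : GenFun G) ζ
      rw [hh f ζ, hh g ζ] at h3
      exact (hh (f + g) ζ).trans (h2.trans h3.symm)
  have hsmul : ∀ (c : ℂ) (f : GenFunZero G), h (c • f) = c • h f := fun c f =>
    Subtype.ext <| GenFun.ext_pairing fun ζ => by
      have h1 : (convProduct G).zeroAct (c • f) ζ = c • (convProduct G).zeroAct f ζ := by
        rw [map_smul, LinearMap.smul_apply]
      have h2 := (congrArg n h1).trans (n.map_smul c ((convProduct G).zeroAct f ζ))
      have h3 := pairing_smul_left c (h f : GenFun G) ζ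
      rw [hh f ζ] at h3
      exact (hh (c • f) ζ).trans (h2.trans h3.symm)
  let T : GenFunZero G →ₗ[ℂ] GenFunZero G :=
    { toFun := h
      map_add' := hadd
      map_smul' := hsmul }
  have hT : ∀ f, ‖T f‖ ≤ ‖n‖ * ‖f‖ := fun f =>
    norm_le_of_norm_pairing_le (h f : GenFun G) (mul_nonneg (norm_nonneg n) (norm_nonneg f))
      fun ζ => (congrArg norm (hh f ζ)).trans_le ((convProduct G).norm_apply_zeroAct_le n f ζ)
  exact ⟨T.mkContinuous ‖n‖ hT, fun f => isLeftDualAct_iff.2 (hh f)⟩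

theorem existsUnique_isArensProduct (m n : StrongDual ℂ (GenFunZero G)) :
    ∃! p : StrongDual ℂ (GenFunZero G), IsArensProduct (GenFunZero G) m n p := by
  obtain ⟨T, hT⟩ := exists_leftDualAct_clm n
  refine ⟨m.comp T, fun f h hf => ?_, fun p hp => ContinuousLinearMap.ext fun f => hp f _ (hT f)⟩
  have e : T f = h := Subtype.ext <| GenFun.ext_pairing fun ζ => by
    rw [isLeftDualAct_iff.1 (hT f), isLeftDualAct_iff.1 hf]
  rw [ContinuousLinearMap.comp_apply, e]

end Group

end GeneralisedFunctions

theorem proposition4p1 {G : Type*} [Group G] [TopologicalSpace G] [IsTopologicalGroup G]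
    [LocallyCompactSpace G] [T2Space G] [MeasurableSpace G] [BorelSpace G] :
    GeneralisedFunctions.IsLeftIntroverted (GeneralisedFunctions.GenFunZero G) ∧
      GeneralisedFunctions.IsRightIntroverted (GeneralisedFunctions.GenFunZero G) ∧
      ∀ m n : StrongDual ℂ (GeneralisedFunctions.GenFunZero G),
        ∃! p : StrongDual ℂ (GeneralisedFunctions.GenFunZero G),
          GeneralisedFunctions.IsArensProduct (GeneralisedFunctions.GenFunZero G) m n p :=
  ⟨GeneralisedFunctions.isLeftIntroverted_genFunZero,
    GeneralisedFunctions.isRightIntroverted_genFunZero,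
    GeneralisedFunctions.existsUnique_isArensProduct⟩
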